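/- Let $\ell^2(\mathcal E)=\mathcal E\oplus\mathcal E\oplus\cdots$ for a Hilbert space $\mathcal E$, let $T_z(e_0,e_1,\dots)=(0,e_0,e_1,\dots)$ be the unilateral shift on $\ell^2(\mathcal E)$, and let $\mathcal H=\ell^2(\mathbb C^2)^{\oplus 4}$. The closed tetrablock is $\overline{\mathbb E}=\{\pi(M): M\in M_2(\mathbb C),\ \|M\|\le 1\}\subset\mathbb C^3$, where $\pi(M)=(m_{11},m_{22},\det M)$, and its distinguished boundary is $b\mathbb E=\{\pi(M): M \text{ unitary}\}$. A *tetrablock contraction* is a commuting triple of bounded operators on a Hilbert space having $\overline{\mathbb E}$ as a spectral set, i.e. its Taylor joint spectrum lies in $\overline{\mathbb E}$ and $\|f(T)\|\le\sup_{\overline{\mathbb E}}|f|$ for every rational function $f$ with poles off $\overline{\mathbb E}$. A *tetrablock unitary* is a commuting triple of normal operators with joint spectrum in $b\mathbb E$; a *tetrablock isometry* is the restriction of a tetrablock unitary to a joint invariant subspace. A *tetrablock isometric dilation* of $(A,B,P)$ on $\mathcal H$ is a tetrablock isometry $(V_1,V_2,V_3)$ on a Hilbert space $\mathcal K\supseteq\mathcal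 H$ with $V_1^*|_{\mathcal H}=A^*$, $V_2^*|_{\mathcal H}=B^*$, $V_3^*|_{\mathcal H}=P^*$. Let $\alpha\in\mathbb C$, $|\alpha|\le 1$. Put $H_1=\begin{bmatrix}0&\alpha\\0&0\end{bmatrix}$, let $H(c_0,c_1,\dots)=(H_1c_0,0,0,\dots)$ on $\ell^2(\mathbb C^2)$, and on $\mathcal H$ let $$A=A_\alpha=\begin{bmatrix}0&0&0&0\\0&0&0&0\\0&0&H&0\\0&0&0&0\end{bmatrix},\quad B=0,\quad P=\begin{bmatrix}0&0&0&0\\0&0&0&0\\0&T_z&0&0\\I&0&0&0\end{bmatrix}.$$ Let $D_P=(I-P^*P)^{1/2}$ and let $\mathcal D_P$ be the closure of its range. Let $F_1=0\oplus\begin{bmatrix}H&0\\0&0\end{bmatrix}$ and $F_2=0$ on $\mathcal D_P$. Then: 1. $D_P(x_1,x_2,x_3,x_4)=(0,0,x_3,x_4)$ and $\mathcal D_P=\{0\}\oplus\{0\}\oplus\ell^2(\mathbb C^2)\oplus\ell^2(\mathbb C^2)$. 2. $X=F_1$ is the unique bounded operator on $\mathcal D_P$ with $A-B^*P=D_PXD_P$,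 and $X=F_2$ is the unique one with $B-A^*P=D_PXD_P$. Moreover $F_1F_2=F_2F_1$, and if $\alpha\ne0$ then $[F_1,F_1^*]\ne[F_2,F_2^*]$, where $[X,Y]=XY-YX$. 3. On $\mathcal K=\mathcal H\oplus\mathcal D_P\oplus\mathcal D_P\oplus\cdots$ the formulas $$\begin{aligned}V_1(h,x_0,x_1,\dots)&=(Ah,\ F_1^*D_Ph+F_1x_0,\ F_1^*x_0+F_1x_1,\ F_1^*x_1+F_1x_2,\dots),\\ V_2(h,x_0,x_1,\dots)&=(Bh,\ F_1D_Ph,\ F_1^*D_Ph+F_1x_0,\ F_1^*x_0+F_1x_1,\dots),\\ V_3(h,x_0,x_1,\dots)&=(Ph,\ 0,\ D_Ph,\ x_0,\ x_1,\dots)\end{aligned}$$ define commuting bounded operators. The operator $V_3$ is an isometry whose restriction to $\mathcal K\ominus\mathcal H=\ell^2(\mathcal D_P)$ is $T_z^2$. Also $V_1=V_2^*V_3$ and $\|V_1\|=\|V_2\|=|\alpha|$. The triple $(V_1,V_2,V_3)$ is a tetrablock isometric dilation of $(A_\alpha,0,P)$. 4. In particular $(A_\alpha,0,P)$ is a tetrablock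 contraction. -/

import Mathlib

open ContinuousLinearMap (adjoint)
open scoped InnerProductSpace

noncomputable section

namespace Tetrablock

/-! ### The tetrablock and its distinguished boundary -/

/-- The map `π : M₂(ℂ) → ℂ³`, `π(M) = (m₁₁, m₂₂, det M)`. -/
def piMap (M : Matrix (Fin 2) (Fin 2) ℂ) : Fin 3 → ℂ := ![M 0 0, M 1 1, M.det]

/-- The closed tetrablock: the image under `π` of the closed unit ball of `M₂(ℂ)` for the
operator norm on the Euclidean space `ℂ²`. -/
def closedTetrablock : Set (Fin 3 → ℂ) :=
  {z | ∃ M : Matrix (Fin 2) (Fin 2) ℂ, ‖Matrix.toEuclideanCLM (𝕜 := ℂ) M‖ ≤ 1 ∧ z = piMap M}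

/-- The distinguished boundary of the tetrablock: the image under `π` of the unitary matrices. -/
def distinguishedBoundary : Set (Fin 3 → ℂ) :=
  {z | ∃ M ∈ Matrix.unitaryGroup (Fin 2) ℂ, z = piMap M}

section Operators

universe u

variable {E : Type u} [NormedAddCommGroup E] [InnerProductSpace ℂ E]

/-! ### Taylor joint spectrum and spectral sets, for triples of operators -/

/-- Exactness of the Koszul complex `0 → E → E³ → E³ → E → 0` of a triple `(a, b, c)`, with
differentials `x ↦ (a x, b x, c x)`, `(x, y, z) ↦ (a y - b x, a z - c x, b z - c y)` and
`(u, v, w) ↦ a w - b v + c u` (in the bases `e₁, e₂, e₃` and `e₁₂, e₁₃, e₂₃`). -/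
def KoszulExact (a b c : E →L[ℂ] E) : Prop :=
  (∀ x, a x = 0 → b x = 0 → c x = 0 → x = 0) ∧
  (∀ x y z, a y - b x = 0 → a z - c x = 0 → b z - c y = 0 →
    ∃ t, x = a t ∧ y = b t ∧ z = c t) ∧
  (∀ u v w, a w - b v + c u = 0 →
    ∃ x y z, u = a y - b x ∧ v = a z - c x ∧ w = b z - c y) ∧
  (∀ s, ∃ u v w, s = a w - b v + c u)

/-- The Taylor joint spectrum of a (commuting) triple: the set of all `l ∈ ℂ³` such that the
Koszul complex of `(T₁ - l₁, T₂ - l₂, T₃ - l₃)` is not exact. -/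
def taylorSpectrum (T : Fin 3 → (E →L[ℂ] E)) : Set (Fin 3 → ℂ) :=
  {l | ¬ KoszulExact (T 0 - l 0 • ContinuousLinearMap.id ℂ E)
      (T 1 - l 1 • ContinuousLinearMap.id ℂ E) (T 2 - l 2 • ContinuousLinearMap.id ℂ E)}

/-- The value `p(T₁, T₂, T₃)` of a polynomial in three variables at a (commuting) triple. -/
def polyEval (T : Fin 3 → (E →L[ℂ] E)) (p : MvPolynomial (Fin 3) ℂ) : E →L[ℂ] E :=
  ∑ m ∈ p.support, p.coeff m • (T 0 ^ m 0 * T 1 ^ m 1 * T 2 ^ m 2)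

/-- `K` is a spectral set for the (commuting) triple `T`: the Taylor joint spectrum of `T` lies
in `K`, and `‖f(T)‖ ≤ sup_K |f|` for every rational function `f = p / q` with poles off `K`.
Here `f(T) = p(T) q(T)⁻¹`, and `q(T)` is required to be invertible. The bound by the supremum
is expressed as a bound by each upper bound `C` of `|f|` on `K`. -/
def IsSpectralSet (K : Set (Fin 3 → ℂ)) (T : Fin 3 → (E →L[ℂ] E)) : Prop :=
  taylorSpectrum T ⊆ K ∧
  ∀ p q : MvPolynomial (Fin 3) ℂ, (∀ z ∈ K, MvPolynomial.eval z q ≠ 0) →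
    IsUnit (polyEval T q) ∧
    ∀ C : ℝ, (∀ z ∈ K, ‖MvPolynomial.eval z p / MvPolynomial.eval z q‖ ≤ C) →
      ‖polyEval T p * Ring.inverse (polyEval T q)‖ ≤ C

/-! ### Tetrablock contractions, unitaries, isometries and dilations -/

/-- A tetrablock contraction: a commuting triple of bounded operators having the closed tetrablock
as a spectral set. -/
structure IsTetrablockContraction (T : Fin 3 → (E →L[ℂ] E)) : Prop where
  commute : ∀ i j, Commute (T i) (T j)
  spectral : IsSpectralSet closedTetrablock T

/-- A tetrablock unitary: a commuting triple of normal operators whose joint spectrum lies in the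
distinguished boundary of the tetrablock. -/
structure IsTetrablockUnitary [CompleteSpace E] (N : Fin 3 → (E →L[ℂ] E)) : Prop where
  commute : ∀ i j, Commute (N i) (N j)
  normal : ∀ i, IsStarNormal (N i)
  spectrum_subset : taylorSpectrum N ⊆ distinguishedBoundary

/-- A tetrablock isometry: the restriction of a tetrablock unitary to a joint invariant subspace
(the subspace being given as the range of a linear isometry `J`). -/
def IsTetrablockIsometry (V : Fin 3 → (E →L[ℂ] E)) : Prop :=
  ∃ (L : Type u) (_ : NormedAddCommGroup L) (_ : InnerProductSpace ℂ L) (_ : CompleteSpace L)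
    (N : Fin 3 → (L →L[ℂ] L)) (J : E →ₗᵢ[ℂ] L),
    IsTetrablockUnitary N ∧ ∀ i x, N i (J x) = J (V i x)

/-- `V` on `E` is a tetrablock isometric dilation of `T` on `G`, where `G` is regarded as a closed
subspace of `E` by the linear isometry `incl`: `V` is a tetrablock isometry and
`Vᵢ^*|_G = Tᵢ^*` for each `i` (so that `G` is co-invariant). -/
structure IsTetrablockIsometricDilation {G : Type*} [NormedAddCommGroup G] [InnerProductSpace ℂ G]
    [CompleteSpace G] [CompleteSpace E] (incl : G →ₗᵢ[ℂ] E)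
    (T : Fin 3 → (G →L[ℂ] G)) (V : Fin 3 → (E →L[ℂ] E)) : Prop where
  isometry : IsTetrablockIsometry V
  adjoint_restrict : ∀ i x, adjoint (V i) (incl x) = incl (adjoint (T i) x)

/-! ### Defect operators -/

/-- The defect operator `D_T = (I - T^* T)^{1/2}` of a contraction `T`. -/
def defect [CompleteSpace E] (T : E →L[ℂ] E) : E →L[ℂ] E :=
  CFC.sqrt (1 - adjoint T * T)

/-- The defect space `𝒟_T`, the closure of the range of `D_T`. -/
def defectSpace [CompleteSpace E] (T : E →L[ℂ] E) : Submodule ℂ E :=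
  (LinearMap.range (defect T).toLinearMap).topologicalClosure

instance [CompleteSpace E] (T : E →L[ℂ] E) : CompleteSpace (defectSpace T) :=
  (Submodule.isClosed_topologicalClosure _).completeSpace_coe

/-- The defect operator as an operator `D_T : E → 𝒟_T`. -/
def defectTo [CompleteSpace E] (T : E →L[ℂ] E) : E →L[ℂ] defectSpace T :=
  (defect T).codRestrict (defectSpace T) fun x =>
    Submodule.le_topologicalClosure _ (LinearMap.mem_range_self _ x)

/-- The operator `D_T X D_T` on `E`, for an operator `X` on the defect space `𝒟_T`. -/
def defectSandwich [CompleteSpace E] (T : E →L[ℂ] E)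
    (X : defectSpace T →L[ℂ] defectSpace T) : E →L[ℂ] E :=
  defect T ∘L (defectSpace T).subtypeL ∘L X ∘L defectTo T

/-- The compression to a complete subspace `S` of an operator `T`
(the restriction of `T` to `S` if `S` is invariant under `T`). -/
def compression (S : Submodule ℂ E) [CompleteSpace S] (T : E →L[ℂ] E) : S →L[ℂ] S :=
  S.orthogonalProjectionOnto ∘L T ∘L S.subtypeL

end Operators

/-! ### Sequence spaces -/

/-- `ℓ²(E)`, the Hilbert space direct sum of countably many copies of `E`. -/
abbrev Ell2 (E : Type*) [NormedAddCommGroup E] : Type _ := lp (fun _ : ℕ => E) 2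

section Sequences

variable {E : Type*} [NormedAddCommGroup E]

/-- The sequence `(0, x₀, x₁, …)`. -/
def shiftFun (x : ℕ → E) : ℕ → E
  | 0 => 0
  | n + 1 => x n

theorem hasSum_shiftFun (x : Ell2 E) :
    HasSum (fun n => ‖shiftFun (x : ℕ → E) n‖ ^ (2 : ENNReal).toReal)
      (‖x‖ ^ (2 : ENNReal).toReal) := by
  have h := lp.hasSum_norm (p := 2) (by norm_num) x
  rw [← hasSum_nat_add_iff' 1]
  simpa [shiftFun] using h

/-- The unilateral shift `T_z (e₀, e₁, …) = (0, e₀, e₁, …)` on `ℓ²(E)`. -/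
def shift (E : Type*) [NormedAddCommGroup E] [InnerProductSpace ℂ E] : Ell2 E →L[ℂ] Ell2 E :=
  LinearMap.mkContinuous
    { toFun := fun x => ⟨shiftFun x, memℓp_gen (hasSum_shiftFun x).summable⟩
      map_add' := fun x y => by
        ext1; funext n
        cases n with
        | zero => exact (add_zero (0 : E)).symm
        | succ n => rfl
      map_smul' := fun c x => by
        ext1; funext n
        cases n with
        | zero => exact (smul_zero c).symm
        | succ n => rfl }
    1 fun x => by
      rw [one_mul]
      refine lp.norm_le_of_forall_sum_le (p := 2) (by norm_num) (norm_nonneg _) fun s => ?_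
      exact sum_le_hasSum s (fun _ _ => by positivity) (hasSum_shiftFun x)

theorem shift_apply_zero [InnerProductSpace ℂ E] (x : Ell2 E) : shift E x 0 = 0 := rfl

theorem shift_apply_succ [InnerProductSpace ℂ E] (x : Ell2 E) (n : ℕ) : shift E x (n + 1) = x n := rfl

end Sequences

/-! ### The example -/

/-- `ℓ²(ℂ²)`. -/
abbrev L : Type := Ell2 (EuclideanSpace ℂ (Fin 2))

/-- `ℋ = ℓ²(ℂ²) ⊕ ℓ²(ℂ²) ⊕ ℓ²(ℂ²) ⊕ ℓ²(ℂ²)`. -/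
abbrev HSpace : Type := PiLp 2 fun _ : Fin 4 => L

/-- The operator on `ℋ` with a given `4 × 4` block operator matrix. -/
def blockOp (M : Matrix (Fin 4) (Fin 4) (L →L[ℂ] L)) : HSpace →L[ℂ] HSpace :=
  ((PiLp.continuousLinearEquiv 2 ℂ fun _ : Fin 4 => L).symm : (Fin 4 → L) →L[ℂ] HSpace) ∘L
    ContinuousLinearMap.pi fun i => ∑ j, M i j ∘L PiLp.proj 2 (fun _ : Fin 4 => L) j

theorem blockOp_apply (M : Matrix (Fin 4) (Fin 4) (L →L[ℂ] L)) (x : HSpace) (i : Fin 4) :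
    blockOp M x i = ∑ j, M i j (x j) := by
  simp [blockOp]

/-- The operator `H (c₀, c₁, c₂, …) = (H₁ c₀, 0, 0, …)` on `ℓ²(ℂ²)`, where `H₁` is the `2 × 2`
matrix with the entry `α` in the upper right corner and zeros elsewhere. -/
def opH (α : ℂ) : L →L[ℂ] L :=
  lp.singleContinuousLinearMap ℂ (fun _ : ℕ => EuclideanSpace ℂ (Fin 2)) 2 0 ∘L
    Matrix.toEuclideanCLM (𝕜 := ℂ) !![0, α; 0, 0] ∘L
    lp.evalCLM ℂ (fun _ : ℕ => EuclideanSpace ℂ (Fin 2)) 2 0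

/-- The operator `A_α` on `ℋ`. -/
def opA (α : ℂ) : HSpace →L[ℂ] HSpace :=
  blockOp !![0, 0, 0, 0;
             0, 0, 0, 0;
             0, 0, opH α, 0;
             0, 0, 0, 0]

/-- The operator `B = 0` on `ℋ`. -/
def opB : HSpace →L[ℂ] HSpace := 0

/-- The operator `P` on `ℋ`. -/
def opP : HSpace →L[ℂ] HSpace :=
  blockOp !![0, 0, 0, 0;
             0, 0, 0, 0;
             0, shift (EuclideanSpace ℂ (Fin 2)), 0, 0;
             1, 0, 0, 0]

/-- The triple `(A_α, B, P)`, that is, `(A_α, 0, P)`. -/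
def triple (α : ℂ) : Fin 3 → (HSpace →L[ℂ] HSpace) := ![opA α, opB, opP]

/-- The defect space `𝒟_P`. -/
abbrev DP : Submodule ℂ HSpace := defectSpace opP

/-- The operator `F₁` on `𝒟_P`: the part in `𝒟_P` of the block operator with the single nonzero
entry `H` in the third diagonal place. -/
def opF₁ (α : ℂ) : DP →L[ℂ] DP :=
  compression DP (blockOp (Matrix.diagonal ![0, 0, opH α, 0]))

/-- The operator `F₂ = 0` on `𝒟_P`. -/
def opF₂ : DP →L[ℂ] DP := 0

/-- `𝒦 = ℋ ⊕ 𝒟_P ⊕ 𝒟_P ⊕ ⋯`. -/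
abbrev KSpace : Type := WithLp 2 (HSpace × Ell2 DP)

/-- The inclusion of `ℋ` into `𝒦` as the first summand. -/
def inclH : HSpace →ₗᵢ[ℂ] KSpace where
  toFun h := WithLp.toLp 2 (h, 0)
  map_add' x y :=
    congrArg (WithLp.toLp 2) (Prod.ext rfl (add_zero (0 : Ell2 DP)).symm)
  map_smul' c x :=
    congrArg (WithLp.toLp 2) (Prod.ext rfl (smul_zero (A := Ell2 DP) c).symm)
  norm_map' x := by
    change ‖WithLp.toLp 2 (x, (0 : Ell2 DP))‖ = ‖x‖
    simp

end Tetrablock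

end

/-! Let `U` be the bilateral shift on two-sided sequences in `DP`, and let `F = F₁` act on each
term. The triple `N = (F + F^* U, U (F + F^* U), U²)` consists of commuting normal operators, with
`N₃` unitary and `N₁ = N₂^* N₃`. Since `F² = 0`, `N₁^* N₁ = F F^* + F^* F`, which is `|α|²` times a
projection; so `‖N₁‖, ‖N₂‖ ≤ |α| ≤ 1`. Such a triple is a tetrablock unitary: off `bE` the shifted
triple is jointly bounded below, which for commuting normal operators makes its Koszul complex
exact.

The space `𝒦` embeds isometrically in the two-sided sequences by sending `(h, x₀, x₁, …)` to `(…, 0,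
P h, 0, D_P h, x₀, x₁, …)`, because `‖P h‖² + ‖D_P h‖² = ‖h‖²`. The relations `A P = A^* P = P A =
P² = 0` and `D_P P = P` make the image invariant under `N`, and the restriction is `(V₁, V₂, V₃)`.
Commutativity, the isometry property, `V₁ = V₂^* V₃` and the upper norm bounds pass to the
restriction; `biTriple_embed` carries this.

The contraction property is proved directly. As `A² = P² = A P = P A = 0`, the joint spectrum lies
in `{0}`, and `f(A, 0, P) = f(0) + ∂₁f(0) A + ∂₃f(0) P`. This operator splits into blocks `[[a, 0],
[c, a]]`. The Schwarz–Pick inequality on the discs `w ↦ (wα, 0, 0)` and `w ↦ (0, 0, w)` of the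
tetrablock bounds each block by `sup |f|`. -/

noncomputable section

namespace Tetrablock

/-! ### Exactness criteria for the Koszul complex. -/

section Koszul

universe u

variable {E : Type u} [NormedAddCommGroup E] [InnerProductSpace ℂ E]

/-- The Koszul complex of a triple is exact if the triple has a left inverse consisting of
operators that commute with the triple. -/
theorem koszulExact_of_sum_mul_eq_one {T S : Fin 3 → (E →L[ℂ] E)}
    (hc : ∀ i j, Commute (T i) (S j)) (h1 : S 0 * T 0 + S 1 * T 1 + S 2 * T 2 = 1) :
    KoszulExact (T 0) (T 1) (T 2) := by
  have hc' : ∀ i j x, T i (S j x) = S j (T i x) := fun i j x =>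
    congrArg (fun f : E →L[ℂ] E => f x) (hc i j).eq
  have h1' : ∀ x, S 0 (T 0 x) + S 1 (T 1 x) + S 2 (T 2 x) = x := fun x =>
    congrArg (fun f : E →L[ℂ] E => f x) h1
  -- The preimages below are the values of the contracting homotopy of the complex given by
  -- contraction against `S`.
  refine ⟨fun x h0 h1 h2 => ?_, fun x y z hxy hxz hyz => ?_, fun u v w h => ?_, fun s => ?_⟩
  · rw [← h1' x, h0, h1, h2]; simp
  · rw [sub_eq_zero] at hxy hxz hyz
    refine ⟨S 0 x + S 1 y + S 2 z, ?_, ?_, ?_⟩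
    · rw [map_add, map_add, hc', hc', hc', hxy, hxz, h1']
    · rw [map_add, map_add, hc', hc', hc', ← hxy, hyz, h1']
    · rw [map_add, map_add, hc', hc', hc', ← hxz, ← hyz, h1']
  · have hS : ∀ i, S i (T 0 w) - S i (T 1 v) + S i (T 2 u) = 0 := fun i => by
      rw [← map_sub, ← map_add, h, map_zero]
    refine ⟨-(S 1 u + S 2 v), S 0 u - S 2 w, S 0 v + S 1 w, ?_, ?_, ?_⟩ <;>
      simp only [map_neg, map_add, map_sub, hc']
    · linear_combination (norm := abel) -h1' u + hS 2
    · linear_combination (norm := abel) -h1' v - hS 1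
    · linear_combination (norm := abel) -h1' w + hS 0
  · refine ⟨S 2 s, -S 1 s, S 0 s, ?_⟩
    rw [map_neg, hc', hc', hc']
    nth_rewrite 1 [← h1' s]
    abel

/-- The Koszul complex of a commuting triple with an invertible member is exact. -/
theorem koszulExact_of_isUnit {T : Fin 3 → (E →L[ℂ] E)} (hc : ∀ i j, Commute (T i) (T j))
    {k : Fin 3} (hk : IsUnit (T k)) : KoszulExact (T 0) (T 1) (T 2) := by
  obtain ⟨u, hu⟩ := hk
  refine koszulExact_of_sum_mul_eq_one (S := Pi.single k ↑u⁻¹) (fun i j => ?_) ?_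
  · by_cases hj : j = k
    · subst hj
      rw [Pi.single_eq_same]
      exact (hu ▸ hc i j : Commute (T i) (u : E →L[ℂ] E)).units_inv_right
    · rw [Pi.single_eq_of_ne hj]
      exact Commute.zero_right _
  · have := u.inv_mul
    rw [hu] at this
    fin_cases k <;> simpa using this

/-- The Koszul complex of a commuting triple of normal operators that is jointly bounded below
is exact. -/
theorem koszulExact_of_normal [CompleteSpace E] {T : Fin 3 → (E →L[ℂ] E)}
    (hc : ∀ i j, Commute (T i) (T j)) (hn : ∀ i, IsStarNormal (T i)) {c : ℝ} (hc0 : 0 < c)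
    (h : ∀ x, c * ‖x‖ ≤ ‖T 0 x‖ + ‖T 1 x‖ + ‖T 2 x‖) : KoszulExact (T 0) (T 1) (T 2) := by
  -- Fuglede's theorem.
  have hstar : ∀ i j, Commute (T i) (star (T j)) := fun i j =>
     (hn j).commute_star_right (hc i j)
  set R : E →L[ℂ] E := star (T 0) * T 0 + star (T 1) * T 1 + star (T 2) * T 2 with hR
  have hTR : ∀ i, Commute (T i) R := fun i =>
    (((hstar i 0).mul_right (hc i 0)).add_right ((hstar i 1).mul_right (hc i 1))).add_right
      ((hstar i 2).mul_right (hc i 2))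
  have hinner : ∀ x, ⟪R x, x⟫_ℂ = ((‖T 0 x‖ ^ 2 + ‖T 1 x‖ ^ 2 + ‖T 2 x‖ ^ 2 : ℝ) : ℂ) := by
    intro x
    simp only [hR, ContinuousLinearMap.star_eq_adjoint, add_apply,
      mul_apply_eq_comp, inner_add_left, ContinuousLinearMap.adjoint_inner_left,
      inner_self_eq_norm_sq_to_K]
    push_cast
    rfl
  have hunit : IsUnit R := by
    -- The factor `1/3` comes from `(a + b + c)² ≤ 3 (a² + b² + c²)`.
    refine ContinuousLinearMap.isUnit_of_forall_le_norm_inner_map R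
      (c := (c ^ 2 / 3).toNNReal) (Real.toNNReal_pos.mpr (by positivity)) fun x => ?_
    rw [hinner, Complex.norm_real, Real.norm_of_nonneg (by positivity)]
    rw [Real.coe_toNNReal _ (by positivity)]
    have h2 : (c * ‖x‖) ^ 2 ≤ (‖T 0 x‖ + ‖T 1 x‖ + ‖T 2 x‖) ^ 2 :=
      pow_le_pow_left₀ (by positivity) (h x) 2
    nlinarith [sq_nonneg (‖T 0 x‖ - ‖T 1 x‖), sq_nonneg (‖T 0 x‖ - ‖T 2 x‖),
      sq_nonneg (‖T 1 x‖ - ‖T 2 x‖)]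
  obtain ⟨u, hu⟩ := hunit
  refine koszulExact_of_sum_mul_eq_one (S := fun i => ↑u⁻¹ * star (T i)) (fun i j => ?_) ?_
  · exact (hu ▸ hTR i : Commute (T i) (u : E →L[ℂ] E)).units_inv_right.mul_right (hstar i j)
  · have := u.inv_mul
    rw [hu, hR] at this
    simpa only [mul_add, mul_assoc] using this

end Koszul

/-! ### Points of the distinguished boundary and tetrablock unitaries. -/

section Boundary

/-- Completes the prescribed diagonal to the unitary matrix with rows `(l₀, b)` and `(-b l₂, l₁)`,
where `b = √(1 - |l₁|²)`; its determinant is `l₂ (|l₁|² + b²) = l₂`. -/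
theorem mem_distinguishedBoundary {l : Fin 3 → ℂ} (h1 : ‖l 1‖ ≤ 1) (h2 : ‖l 2‖ = 1)
    (h0 : l 0 = star (l 1) * l 2) : l ∈ distinguishedBoundary := by
  have hz : l 2 * star (l 2) = 1 := by
    rw [Complex.star_def, Complex.mul_conj, Complex.normSq_eq_norm_sq, h2]; simp
  set b : ℂ := ((Real.sqrt (1 - ‖l 1‖ ^ 2) : ℝ) : ℂ) with hb
  have hbstar : star b = b := by rw [hb, Complex.star_def, Complex.conj_ofReal]
  have hbb : l 1 * star (l 1) + b * b = 1 := by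
    rw [Complex.star_def, Complex.mul_conj, Complex.normSq_eq_norm_sq, hb, ← Complex.ofReal_mul,
      Real.mul_self_sqrt (by nlinarith [norm_nonneg (l 1)])]
    push_cast; ring
  refine ⟨!![l 0, b; -b * l 2, l 1], ?_, ?_⟩
  · rw [Matrix.mem_unitaryGroup_iff]
    ext i j
    fin_cases i <;> fin_cases j <;>
      simp [Matrix.mul_apply, Fin.sum_univ_two, Matrix.star_apply, h0] <;>
      simp only [← Complex.star_def, hbstar]
    · linear_combination hbb + l 1 * star (l 1) * hz
    · linear_combination -(star (l 1) * b) * hz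
    · linear_combination -(b * l 1) * hz
    · linear_combination hbb + b * b * hz
  · funext i
    fin_cases i
    · simp [piMap]
    · simp [piMap]
    · simp [piMap, Matrix.det_fin_two, h0]
      simp only [← Complex.star_def]
      linear_combination -l 2 * hbb

end Boundary

section Unitary

universe u

variable {E : Type u} [NormedAddCommGroup E] [InnerProductSpace ℂ E] [CompleteSpace E]

/-- A commuting triple of normal operators `(N₁, N₂, N₃)` with `N₃` unitary, `N₁ = N₂^* N₃` and
`N₂` a contraction is a tetrablock unitary. -/
theorem isTetrablockUnitary_of_unitary {N : Fin 3 → (E →L[ℂ] E)}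
    (hc : ∀ i j, Commute (N i) (N j)) (hn : ∀ i, IsStarNormal (N i))
    (h0 : N 0 = adjoint (N 1) * N 2) (h1 : ‖N 1‖ ≤ 1) (h2 : ∀ x, ‖N 2 x‖ = ‖x‖) :
    IsTetrablockUnitary N := by
  refine ⟨hc, hn, fun l hl => ?_⟩
  by_contra hmem
  apply hl
  -- A point outside `bE` violates one of `|l₂| = 1`, `|l₁| ≤ 1`, `l₀ = conj(l₁) l₂`, and each
  -- violation yields a joint lower bound.
  have key : ∃ c : ℝ, 0 < c ∧ ∀ x, c * ‖x‖ ≤ ‖N 0 x - l 0 • x‖ + ‖N 1 x - l 1 • x‖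
      + ‖N 2 x - l 2 • x‖ := by
    by_cases hl2 : ‖l 2‖ = 1
    · by_cases hl1 : ‖l 1‖ ≤ 1
      · have hne : l 0 - star (l 1) * l 2 ≠ 0 := fun h =>
          hmem (mem_distinguishedBoundary hl1 hl2 (sub_eq_zero.mp h))
        refine ⟨‖l 0 - star (l 1) * l 2‖, norm_pos_iff.mpr hne, fun x => ?_⟩
        -- Normality of `N₂ - l₁` (indices from `0` in the code: `N 1 - l 1`) replaces its adjoint
        -- by itself under the norm, and it commutes with `N 2`.
        have hadj : ‖adjoint (N 1) (N 2 x) - star (l 1) • N 2 x‖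
            = ‖N 2 (N 1 x - l 1 • x)‖ := by
          have hN : IsStarNormal (N 1 - l 1 • (1 : E →L[ℂ] E)) :=
            have := hn 1
            ⟨by
              simp only [star_sub, star_smul, star_one]
              exact ((show Commute (star (N 1)) (N 1) from star_comm_self' (N 1)).sub_right
                ((Commute.one_right _).smul_right _)).sub_left
                (((Commute.one_left _).smul_left _))⟩
          have := (ContinuousLinearMap.isStarNormal_iff_norm_eq_adjoint.mp hN) (N 2 x)
          have hcx : N 1 (N 2 x) = N 2 (N 1 x) :=
            congrArg (fun f : E →L[ℂ] E => f x) (hc 1 2).eq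
          rw [map_sub, map_smul, ← hcx]
          simpa [← ContinuousLinearMap.star_eq_adjoint, star_sub, star_smul] using this.symm
        rw [h2] at hadj
        have hx : (l 0 - star (l 1) * l 2) • x = -(N 0 x - l 0 • x)
            + (adjoint (N 1) (N 2 x) - star (l 1) • N 2 x)
            + star (l 1) • (N 2 x - l 2 • x) := by
          rw [h0, mul_apply_eq_comp]
          module
        rw [← norm_smul, hx, ← hadj]
        refine (norm_add₃_le).trans ?_
        rw [norm_neg, norm_smul, norm_star]
        gcongr
        exact mul_le_of_le_one_left (norm_nonneg _) hl1
      · refine ⟨‖l 1‖ - 1, by linarith [not_le.mp hl1], fun x => ?_⟩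
        have h3 := norm_sub_norm_le (l 1 • x) (N 1 x)
        rw [norm_sub_rev, norm_smul] at h3
        have h4 := (N 1).le_of_opNorm_le h1 x
        nlinarith [norm_nonneg (N 0 x - l 0 • x), norm_nonneg (N 2 x - l 2 • x)]
    · refine ⟨|1 - ‖l 2‖|, abs_pos.mpr (sub_ne_zero.mpr (Ne.symm hl2)), fun x => ?_⟩
      have h3 := abs_norm_sub_norm_le (N 2 x) (l 2 • x)
      rw [h2, norm_smul, ← one_sub_mul, abs_mul, abs_norm] at h3
      linarith [norm_nonneg (N 0 x - l 0 • x), norm_nonneg (N 1 x - l 1 • x)]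
  obtain ⟨c, hc0, hcx⟩ := key
  have hid : ∀ (a : ℂ) (S : E →L[ℂ] E), Commute S (a • ContinuousLinearMap.id ℂ E) :=
    fun a S => (Commute.one_right S).smul_right a
  refine koszulExact_of_normal (T := fun i => N i - l i • ContinuousLinearMap.id ℂ E)
    (fun i j => ?_) (fun i => ?_) hc0 (fun x => by simpa using hcx x)
  · exact ((hc i j).sub_right (hid _ _)).sub_left ((hid _ _).symm)
  · have := hn i
    refine ⟨?_⟩
    rw [star_sub, star_smul, show star (ContinuousLinearMap.id ℂ E) = ContinuousLinearMap.id ℂ E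
      from star_one (E →L[ℂ] E)]
    exact ((show Commute (star (N i)) (N i) from star_comm_self' (N i)).sub_right
                (hid _ _)).sub_left ((hid _ _).symm)

end Unitary

/-! ### Schwarz–Pick and the norm of a triangular `2 × 2` block. -/

section SchwarzPick

open Metric

/-- The Schwarz–Pick inequality at the centre of the unit disc. -/
theorem mul_norm_deriv_le_of_norm_le {g : ℂ → ℂ} {d : ℂ} {C : ℝ}
    (hg : DifferentiableOn ℂ g (ball 0 1)) (hd : HasDerivAt g d 0)
    (hC : ∀ w ∈ ball (0 : ℂ) 1, ‖g w‖ ≤ C) : C * ‖d‖ ≤ C ^ 2 - ‖g 0‖ ^ 2 := by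
  have hC0 : ‖g 0‖ ≤ C := hC 0 (by simp)
  -- With `R` strictly above `C`, the Möbius transform below has no pole; at the end `R` tends to
  -- `C`.
  have main : ∀ R, C < R → R * ‖d‖ ≤ R ^ 2 - ‖g 0‖ ^ 2 := by
    intro R hR
    have hgR : ∀ w ∈ ball (0 : ℂ) 1, ‖g w‖ < R := fun w hw => (hC w hw).trans_lt hR
    have h0 : ‖g 0‖ < R := hC0.trans_lt hR
    have hR0 : 0 < R := (norm_nonneg _).trans_lt h0
    set D : ℂ → ℂ := fun w => (R : ℂ) ^ 2 - star (g 0) * g w with hD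
    have hDne : ∀ w ∈ ball (0 : ℂ) 1, D w ≠ 0 := by
      intro w hw h
      have h1 : (R : ℂ) ^ 2 = star (g 0) * g w := sub_eq_zero.mp h
      have h2 := congrArg norm h1
      rw [norm_pow, Complex.norm_real, Real.norm_of_nonneg hR0.le, norm_mul, norm_star] at h2
      nlinarith [hgR w hw, norm_nonneg (g 0), norm_nonneg (g w)]
    set m : ℂ → ℂ := fun w => R * (g w - g 0) / D w with hm
    have hmd : DifferentiableOn ℂ m (ball 0 1) :=
      ((hg.sub_const _).const_mul _).div ((hg.const_mul _).const_sub _) hDne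
    have hmaps : Set.MapsTo m (ball 0 1) (ball (m 0) 1) := by
      intro w hw
      have hm0 : m 0 = 0 := by simp [hm]
      rw [hm0, mem_ball_zero_iff, hm, norm_div, div_lt_one (norm_pos_iff.mpr (hDne w hw)),
        ← sq_lt_sq₀ (norm_nonneg _) (norm_nonneg _), hD]
      simp only [← Complex.normSq_eq_norm_sq]
      have a1 := hgR w hw
      rw [← sq_lt_sq₀ (norm_nonneg _) hR0.le, ← Complex.normSq_eq_norm_sq,
        Complex.normSq_apply] at a1
      have a2 := h0
      rw [← sq_lt_sq₀ (norm_nonneg _) hR0.le, ← Complex.normSq_eq_norm_sq,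
        Complex.normSq_apply] at a2
      rw [Complex.normSq_apply, Complex.normSq_apply]
      simp [sq]
      -- The difference of the two sides is `(R² - |g w|²)(R² - |g 0|²)`.
      nlinarith [mul_pos (sub_pos.mpr a1) (sub_pos.mpr a2)]
    have hderiv : HasDerivAt m (R * d / D 0) 0 := by
      have h1 := ((hd.sub_const (g 0)).const_mul (R : ℂ)).div
        ((hd.const_mul (star (g 0))).const_sub ((R : ℂ) ^ 2)) (hDne 0 (by simp))
      refine h1.congr_deriv ?_
      have := hDne 0 (by simp)
      simp only [hD] at this ⊢
      field_simp
      ring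
    have h3 := Complex.norm_deriv_le_div_of_mapsTo_ball hmd
      (hmaps.mono_right ball_subset_closedBall) one_pos
    have hD0 : D 0 = ((R ^ 2 - ‖g 0‖ ^ 2 : ℝ) : ℂ) := by
      simp only [hD]
      rw [mul_comm, Complex.star_def, Complex.mul_conj, Complex.normSq_eq_norm_sq]
      push_cast; ring
    have hpos : 0 < R ^ 2 - ‖g 0‖ ^ 2 := by nlinarith [norm_nonneg (g 0)]
    rw [hderiv.deriv, hD0, norm_div, norm_mul, Complex.norm_real, Complex.norm_real,
      Real.norm_of_nonneg hR0.le, Real.norm_of_nonneg hpos.le, div_one,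
      div_le_one hpos] at h3
    exact h3
  have hlim : ∀ᶠ R in nhdsWithin C (Set.Ioi C), R * ‖d‖ ≤ R ^ 2 - ‖g 0‖ ^ 2 :=
    eventually_nhdsWithin_of_forall main
  refine le_of_tendsto_of_tendsto (b := nhdsWithin C (Set.Ioi C)) ?_ ?_ hlim
  · exact ((continuous_id.mul continuous_const).tendsto C).mono_left nhdsWithin_le_nhds
  · exact (((continuous_id.pow 2).sub continuous_const).tendsto C).mono_left nhdsWithin_le_nhds

/-- If `C |c| ≤ C² - |a|²`, then the operator matrix with rows `(a, 0)` and `(c, a)` has norm at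
most `C`. -/
theorem norm_sq_add_norm_sq_le {E : Type*} [NormedAddCommGroup E] [NormedSpace ℂ E] {a c : ℂ}
    {C : ℝ} (hC : 0 < C) (h : C * ‖c‖ ≤ C ^ 2 - ‖a‖ ^ 2) (x y : E) :
    ‖a • x‖ ^ 2 + ‖c • x + a • y‖ ^ 2 ≤ C ^ 2 * (‖x‖ ^ 2 + ‖y‖ ^ 2) := by
  have h1 : ‖c • x + a • y‖ ≤ ‖c‖ * ‖x‖ + ‖a‖ * ‖y‖ :=
    (norm_add_le _ _).trans_eq (by rw [norm_smul, norm_smul])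
  have h2 : ‖c • x + a • y‖ ^ 2 ≤ (‖c‖ * ‖x‖ + ‖a‖ * ‖y‖) ^ 2 :=
    pow_le_pow_left₀ (norm_nonneg _) h1 2
  rw [norm_smul]
  have hc0 := norm_nonneg c
  have ha0 := norm_nonneg a
  generalize ‖c‖ = c at *
  generalize ‖a‖ = a at *
  generalize ‖x‖ = X at *
  generalize ‖y‖ = Y at *
  refine (add_le_add_right h2 _).trans ?_
  -- The case `c = 0` is separate because `D = C² - a²` may then vanish. For `c > 0`, `D` times the
  -- difference of the two sides is `(D Y - a c X)² + (D² - C² c²) X²`.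
  rcases hc0.eq_or_lt with rfl | hc
  · nlinarith [sq_nonneg X, sq_nonneg Y]
  · have hD : 0 < C ^ 2 - a ^ 2 := (mul_pos hC hc).trans_le h
    have h3 : (C * c) ^ 2 ≤ (C ^ 2 - a ^ 2) ^ 2 := pow_le_pow_left₀ (by positivity) h 2
    rw [← sub_nonneg]
    refine nonneg_of_mul_nonneg_right (b := _) (a := C ^ 2 - a ^ 2) ?_ hD
    have h4 := mul_nonneg (sub_nonneg.mpr h3) (sq_nonneg X)
    linear_combination h4 + sq_nonneg ((C ^ 2 - a ^ 2) * Y - a * c * X)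

end SchwarzPick

/-! ### Compressions, adjoints of the shift and of block operators. -/

section Compression

universe u

variable {E : Type u} [NormedAddCommGroup E] [InnerProductSpace ℂ E] [CompleteSpace E]

theorem adjoint_compression (S : Submodule ℂ E) [CompleteSpace S] (T : E →L[ℂ] E) :
    adjoint (compression S T) = compression S (adjoint T) := by
  symm
  rw [ContinuousLinearMap.eq_adjoint_iff]
  intro x y
  simp [compression, ContinuousLinearMap.adjoint_inner_left]

omit [CompleteSpace E] in
theorem coe_compression_apply (S : Submodule ℂ E) [CompleteSpace S] {T : E →L[ℂ] E} {x : S}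
    (h : T x ∈ S) : (compression S T x : E) = T x := by
  simp [compression, Submodule.starProjection_eq_self_iff.mpr h]

end Compression

section Shift

variable {G : Type*} [NormedAddCommGroup G] [InnerProductSpace ℂ G]

theorem norm_shift (x : Ell2 G) : ‖shift G x‖ = ‖x‖ := by
  have h1 := lp.hasSum_norm (p := 2) (by norm_num) (shift G x)
  have h2 := h1.unique (hasSum_shiftFun x)
  simpa using h2

theorem inner_shift_shift (x y : Ell2 G) : ⟪shift G x, shift G y⟫_ℂ = ⟪x, y⟫_ℂ :=
  (⟨(shift G).toLinearMap, norm_shift⟩ : Ell2 G →ₗᵢ[ℂ] Ell2 G).inner_map_map x y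

theorem adjoint_shift_mul_shift [CompleteSpace G] : adjoint (shift G) * shift G = 1 := by
  ext1 x
  refine ext_inner_right ℂ fun y => ?_
  rw [mul_apply_eq_comp, ContinuousLinearMap.adjoint_inner_left, inner_shift_shift]
  rfl

end Shift

section BlockOperators

theorem adjoint_blockOp (M : Matrix (Fin 4) (Fin 4) (L →L[ℂ] L)) :
    adjoint (blockOp M) = blockOp (M.map adjoint).transpose := by
  symm
  rw [ContinuousLinearMap.eq_adjoint_iff]
  intro x y
  simp only [PiLp.inner_apply, blockOp_apply, inner_sum, sum_inner, Matrix.transpose_apply,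
    Matrix.map_apply, ContinuousLinearMap.adjoint_inner_left]
  exact Finset.sum_comm

end BlockOperators

/-! ### The operator `H` and its products with the shift. -/

section CoefficientOperator

theorem toLp_zero_zero : (!₂[0, 0] : EuclideanSpace ℂ (Fin 2)) = 0 := by
  ext i
  fin_cases i <;> rfl

theorem opH_apply (α : ℂ) (x : L) : opH α x = lp.single 2 0 (!₂[α * x 0 1, 0]) := by
  have heval : lp.evalCLM ℂ (fun _ : ℕ => EuclideanSpace ℂ (Fin 2)) 2 0 x = x 0 := rfl
  simp only [opH, ContinuousLinearMap.comp_apply, lp.singleContinuousLinearMap_apply]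
  congr 1
  ext i
  fin_cases i <;>
    simp [heval, Matrix.ofLp_toEuclideanCLM, Matrix.mulVec, dotProduct, Fin.sum_univ_two]

theorem adjoint_opH_apply (α : ℂ) (x : L) :
    adjoint (opH α) x = lp.single 2 0 (!₂[0, star α * x 0 0]) := by
  refine ext_inner_right ℂ fun y => ?_
  rw [ContinuousLinearMap.adjoint_inner_left, opH_apply, lp.inner_single_right,
    lp.inner_single_left]
  simp [PiLp.inner_apply, Fin.sum_univ_two]
  ring

theorem opH_mul_opH (α : ℂ) : opH α * opH α = 0 := by
  ext1 x
  simp [opH_apply, toLp_zero_zero]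

/-- `H` reads only the zeroth term, which the shift annihilates. This and the analogue for `H^*`
give `A P = 0` and `A^* P = 0`. -/
theorem opH_mul_shift (α : ℂ) : opH α * shift (EuclideanSpace ℂ (Fin 2)) = 0 := by
  ext1 x
  simp [opH_apply, shift_apply_zero, toLp_zero_zero]

theorem adjoint_opH_mul_shift (α : ℂ) :
    adjoint (opH α) * shift (EuclideanSpace ℂ (Fin 2)) = 0 := by
  ext1 x
  simp [adjoint_opH_apply, shift_apply_zero, toLp_zero_zero]

/-- Reduces to `H₁ H₁^* + H₁^* H₁ = |α|² I` on `ℂ²`; it is the source of the norm `|α|` of `V₁` and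
`V₂`. -/
theorem opH_mul_adjoint_add_apply (α : ℂ) (x : L) :
    opH α (adjoint (opH α) x) + adjoint (opH α) (opH α x)
      = ((‖α‖ : ℂ) ^ 2) • lp.single 2 0 (x 0) := by
  rw [opH_apply, adjoint_opH_apply, adjoint_opH_apply, opH_apply, ← lp.single_add, ← lp.single_smul]
  congr 1
  have h : α * star α = (‖α‖ : ℂ) ^ 2 := by
    rw [Complex.star_def, Complex.mul_conj, Complex.normSq_eq_norm_sq]; simp
  ext i
  fin_cases i
  · simp [← h]; ring
  · simp [← h]; ring

end CoefficientOperator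

/-! ### The defect space of `P`, the fundamental operators and the relations among `A`, `P`, `F₁`.
-/

section BlockEntries

theorem opA_apply (α : ℂ) (x : HSpace) : opA α x = WithLp.toLp 2 ![0, 0, opH α (x 2), 0] := by
  ext1 i
  rw [opA, blockOp_apply]
  fin_cases i <;> simp [Fin.sum_univ_four]

theorem adjoint_opA_apply (α : ℂ) (x : HSpace) :
    adjoint (opA α) x = WithLp.toLp 2 ![0, 0, adjoint (opH α) (x 2), 0] := by
  ext1 i
  rw [opA, adjoint_blockOp, blockOp_apply]
  fin_cases i <;> simp [Fin.sum_univ_four]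

theorem opP_apply (x : HSpace) :
    opP x = WithLp.toLp 2 ![0, 0, shift (EuclideanSpace ℂ (Fin 2)) (x 1), x 0] := by
  ext1 i
  rw [opP, blockOp_apply]
  fin_cases i <;> simp [Fin.sum_univ_four]

theorem adjoint_opP_apply (x : HSpace) :
    adjoint opP x
      = WithLp.toLp 2 ![x 3, adjoint (shift (EuclideanSpace ℂ (Fin 2))) (x 2), 0, 0] := by
  ext1 i
  rw [opP, adjoint_blockOp, blockOp_apply]
  fin_cases i <;> simp [Fin.sum_univ_four, ← ContinuousLinearMap.star_eq_adjoint]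

/-- The block matrix defining `F₁` is that of `A`, whose range lies in `DP`; thus facts about `F₁`
can be read off from `A`. -/
theorem opF₁_eq_compression (α : ℂ) : opF₁ α = compression DP (opA α) := by
  unfold opF₁ opA
  congr 2
  ext i j
  fin_cases i <;> fin_cases j <;> simp

/-- The orthogonal projection of `ℋ` onto the sum of the last two summands. -/
def lastTwo : HSpace →L[ℂ] HSpace := blockOp (Matrix.diagonal ![0, 0, 1, 1])

theorem lastTwo_apply (x : HSpace) : lastTwo x = WithLp.toLp 2 ![0, 0, x 2, x 3] := by
  ext1 i
  rw [lastTwo, blockOp_apply]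
  fin_cases i <;> simp [Fin.sum_univ_four, Matrix.diagonal_apply]

theorem isStarProjection_lastTwo : IsStarProjection lastTwo := by
  refine ⟨?_, ?_⟩
  · ext1 x
    simp [lastTwo_apply]
  · rw [IsSelfAdjoint, ContinuousLinearMap.star_eq_adjoint, lastTwo, adjoint_blockOp]
    congr 1
    ext1 i j
    fin_cases i <;> fin_cases j <;> simp [← ContinuousLinearMap.star_eq_adjoint]

theorem one_sub_adjoint_mul_opP : 1 - adjoint opP * opP = lastTwo := by
  have h : ∀ x, adjoint (shift (EuclideanSpace ℂ (Fin 2))) (shift _ x) = x := fun x =>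
    congrArg (fun f : L →L[ℂ] L => f x) adjoint_shift_mul_shift
  ext1 x
  ext1 i
  fin_cases i <;> simp [adjoint_opP_apply, opP_apply, lastTwo_apply, h]

/-- `I - P^* P` is a projection, hence its own positive square root. -/
theorem defect_opP : defect opP = lastTwo := by
  rw [defect, one_sub_adjoint_mul_opP]
  exact CFC.sqrt_unique isStarProjection_lastTwo.isIdempotentElem.eq
    isStarProjection_lastTwo.nonneg

theorem mem_DP_iff (x : HSpace) : x ∈ DP ↔ lastTwo x = x := by
  have hrange : (LinearMap.range (lastTwo : HSpace →L[ℂ] HSpace).toLinearMap : Set HSpace)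
      = {x | lastTwo x = x} := by
    ext y
    constructor
    · rintro ⟨z, rfl⟩
      simp [lastTwo_apply]
    · intro hy
      exact ⟨y, hy⟩
  -- The range of a projection is its fixed-point set, hence already closed.
  have hclosed : IsClosed {x | lastTwo x = x} :=
    isClosed_eq lastTwo.continuous continuous_id
  rw [← SetLike.mem_coe, DP, defectSpace, Submodule.topologicalClosure_coe, defect_opP, hrange,
    hclosed.closure_eq]
  rfl

theorem mem_DP_iff_zero (x : HSpace) : x ∈ DP ↔ x 0 = 0 ∧ x 1 = 0 := by
  rw [mem_DP_iff, lastTwo_apply]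
  constructor
  · intro h
    exact ⟨by rw [← h]; simp, by rw [← h]; simp⟩
  · rintro ⟨h0, h1⟩
    ext1 i
    fin_cases i <;> simp [h0, h1]

theorem coe_defectTo_opP (x : HSpace) : (defectTo opP x : HSpace) = lastTwo x := by
  rw [← defect_opP]
  rfl

theorem defectTo_opP_coe (y : DP) : defectTo opP (y : HSpace) = y :=
  Subtype.ext (by rw [coe_defectTo_opP, (mem_DP_iff _).mp y.2])

theorem opA_mem_DP (α : ℂ) (x : HSpace) : opA α x ∈ DP := by
  rw [mem_DP_iff_zero, opA_apply]; simp

theorem adjoint_opA_mem_DP (α : ℂ) (x : HSpace) : adjoint (opA α) x ∈ DP := by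
  rw [mem_DP_iff_zero, adjoint_opA_apply]; simp

theorem opP_mem_DP (x : HSpace) : opP x ∈ DP := by
  rw [mem_DP_iff_zero, opP_apply]; simp

theorem coe_opF₁ (α : ℂ) (y : DP) : (opF₁ α y : HSpace) = opA α y := by
  rw [opF₁_eq_compression, coe_compression_apply _ (opA_mem_DP _ _)]

theorem coe_adjoint_opF₁ (α : ℂ) (y : DP) :
    (adjoint (opF₁ α) y : HSpace) = adjoint (opA α) y := by
  rw [opF₁_eq_compression, adjoint_compression, coe_compression_apply _ (adjoint_opA_mem_DP _ _)]

theorem defectSandwich_opP_apply (X : DP →L[ℂ] DP) (x : HSpace) :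
    defectSandwich opP X x = X (defectTo opP x) := by
  have := (mem_DP_iff _).mp (X (defectTo opP x)).2
  rw [← defect_opP] at this
  exact this

/-- `D_P` is the identity on `DP`, so `D_P X D_P` determines `X`; this gives existence and
uniqueness at once. -/
theorem eq_defectSandwich_opP_iff {T : HSpace →L[ℂ] HSpace} {Y : DP →L[ℂ] DP}
    (hT : ∀ x, T x = Y (defectTo opP x)) (X : DP →L[ℂ] DP) :
    T = defectSandwich opP X ↔ X = Y := by
  constructor
  · rintro h
    ext1 y
    apply Subtype.ext
    have h1 := hT y
    rw [h, defectSandwich_opP_apply, defectTo_opP_coe] at h1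
    exact h1
  · rintro rfl
    ext1 x
    rw [hT, defectSandwich_opP_apply]

theorem opA_lastTwo (α : ℂ) (x : HSpace) : opA α (lastTwo x) = opA α x := by
  simp [opA_apply, lastTwo_apply]

theorem adjoint_opA_opP (α : ℂ) (x : HSpace) : adjoint (opA α) (opP x) = 0 := by
  have h : adjoint (opH α) (shift _ (x 1)) = 0 :=
    congrArg (fun f : L →L[ℂ] L => f (x 1)) (adjoint_opH_mul_shift α)
  ext1 i
  fin_cases i <;> simp [adjoint_opA_apply, opP_apply, h]

theorem opA_opP (α : ℂ) (x : HSpace) : opA α (opP x) = 0 := by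
  have h : opH α (shift _ (x 1)) = 0 :=
    congrArg (fun f : L →L[ℂ] L => f (x 1)) (opH_mul_shift α)
  ext1 i
  fin_cases i <;> simp [opA_apply, opP_apply, h]

theorem opP_opA (α : ℂ) (x : HSpace) : opP (opA α x) = 0 := by
  ext1 i
  fin_cases i <;> simp [opA_apply, opP_apply]

theorem opA_opA (α : ℂ) (x : HSpace) : opA α (opA α x) = 0 := by
  have h : opH α (opH α (x 2)) = 0 :=
    congrArg (fun f : L →L[ℂ] L => f (x 2)) (opH_mul_opH α)
  ext1 i
  fin_cases i <;> simp [opA_apply, h]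

theorem opP_opP (x : HSpace) : opP (opP x) = 0 := by
  ext1 i
  fin_cases i <;> simp [opP_apply]

theorem norm_sq_HSpace (x : HSpace) :
    ‖x‖ ^ 2 = ‖x 0‖ ^ 2 + ‖x 1‖ ^ 2 + ‖x 2‖ ^ 2 + ‖x 3‖ ^ 2 := by
  rw [PiLp.norm_sq_eq_of_L2, Fin.sum_univ_four]

/-- As `lastTwo` is `D_P`, this is what makes the embedding of `𝒦` isometric. -/
theorem norm_sq_opP_add_lastTwo (x : HSpace) : ‖opP x‖ ^ 2 + ‖lastTwo x‖ ^ 2 = ‖x‖ ^ 2 := by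
  simp only [norm_sq_HSpace, opP_apply, lastTwo_apply]
  simp [norm_shift]
  ring

theorem opF₁_mul_self (α : ℂ) : opF₁ α * opF₁ α = 0 := by
  ext1 y
  apply Subtype.ext
  rw [mul_apply_eq_comp, coe_opF₁, coe_opF₁, opA_opA]
  rfl

theorem opF₁_defectTo (α : ℂ) (x : HSpace) : (opF₁ α (defectTo opP x) : HSpace) = opA α x := by
  rw [coe_opF₁, coe_defectTo_opP, opA_lastTwo]

theorem norm_toLp_two (u : L) : ‖(WithLp.toLp 2 ![0, 0, u, 0] : HSpace)‖ = ‖u‖ := by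
  rw [← sq_eq_sq₀ (norm_nonneg _) (norm_nonneg _), norm_sq_HSpace]
  simp

theorem norm_opF₁_mul_adjoint_add_le (α : ℂ) (y : DP) :
    ‖opF₁ α (adjoint (opF₁ α) y) + adjoint (opF₁ α) (opF₁ α y)‖ ≤ ‖α‖ ^ 2 * ‖y‖ := by
  have h : ((opF₁ α (adjoint (opF₁ α) y) + adjoint (opF₁ α) (opF₁ α y) : DP) : HSpace)
      = WithLp.toLp 2 ![0, 0, ((‖α‖ : ℂ) ^ 2) • lp.single 2 0 ((y : HSpace) 2 0), 0] := by
    rw [Submodule.coe_add, coe_opF₁, coe_adjoint_opF₁, coe_adjoint_opF₁, coe_opF₁,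
      ← opH_mul_adjoint_add_apply]
    ext1 i
    fin_cases i <;> simp [opA_apply, adjoint_opA_apply]
  have h1 : ‖(y : HSpace) 2 0‖ ≤ ‖y‖ :=
    (lp.norm_apply_le_norm two_ne_zero _ 0).trans (PiLp.norm_apply_le (y : HSpace) 2)
  rw [Submodule.coe_norm, h, norm_toLp_two, norm_smul, lp.norm_single (by norm_num), norm_pow,
    Complex.norm_real, norm_norm]
  gcongr

/-- The vector of `ℋ` whose only nonzero entry is the second basis vector of `ℂ²`, in the place
on which `A_α` acts. -/
def cyclicVector : HSpace := WithLp.toLp 2 ![0, 0, lp.single 2 0 !₂[0, 1], 0]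

theorem norm_cyclicVector : ‖cyclicVector‖ = 1 := by
  rw [cyclicVector, norm_toLp_two, lp.norm_single (by norm_num), EuclideanSpace.norm_eq]
  simp

theorem opA_cyclicVector (α : ℂ) :
    opA α cyclicVector = WithLp.toLp 2 ![0, 0, lp.single 2 0 !₂[α, 0], 0] := by
  simp [opA_apply, cyclicVector, opH_apply]

theorem norm_opA_cyclicVector (α : ℂ) : ‖opA α cyclicVector‖ = ‖α‖ := by
  rw [opA_cyclicVector, norm_toLp_two, lp.norm_single (by norm_num), EuclideanSpace.norm_eq]
  simp

theorem adjoint_opA_cyclicVector (α : ℂ) : adjoint (opA α) cyclicVector = 0 := by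
  ext1 i
  fin_cases i <;> simp [adjoint_opA_apply, cyclicVector, adjoint_opH_apply, toLp_zero_zero]

theorem cyclicVector_mem_DP : cyclicVector ∈ DP := by
  rw [mem_DP_iff_zero]; simp [cyclicVector]

/-- At `cyclicVector`, `F₁^*` vanishes and `F₁` does not, so `-F₁^* F₁` is nonzero there. -/
theorem opF₁_selfCommutator_ne_zero {α : ℂ} (hα : α ≠ 0) :
    opF₁ α * adjoint (opF₁ α) - adjoint (opF₁ α) * opF₁ α ≠ 0 := by
  intro h
  have h1 : (opF₁ α) (adjoint (opF₁ α) ⟨cyclicVector, cyclicVector_mem_DP⟩)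
      = adjoint (opF₁ α) (opF₁ α ⟨cyclicVector, cyclicVector_mem_DP⟩) :=
    congrArg (fun f : DP →L[ℂ] DP => f ⟨cyclicVector, cyclicVector_mem_DP⟩) (sub_eq_zero.mp h)
  have h2 : adjoint (opF₁ α) ⟨cyclicVector, cyclicVector_mem_DP⟩ = 0 :=
    Subtype.ext (by rw [coe_adjoint_opF₁, adjoint_opA_cyclicVector]; rfl)
  have h3 : opF₁ α ⟨cyclicVector, cyclicVector_mem_DP⟩ = 0 := by
    rw [← inner_self_eq_zero (𝕜 := ℂ), ← ContinuousLinearMap.adjoint_inner_left, ← h1, h2,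
      map_zero, inner_zero_left]
  have h4 : opA α cyclicVector = 0 := by
    rw [← coe_opF₁ α ⟨cyclicVector, cyclicVector_mem_DP⟩, h3]
    rfl
  have h5 := norm_opA_cyclicVector α
  rw [h4, norm_zero] at h5
  exact hα (norm_eq_zero.mp h5.symm)

theorem zero_selfCommutator {G : Type*} [NormedAddCommGroup G] [InnerProductSpace ℂ G]
    [CompleteSpace G] :
    (0 : G →L[ℂ] G) * adjoint (0 : G →L[ℂ] G) - adjoint (0 : G →L[ℂ] G) * (0 : G →L[ℂ] G) = 0 := by
  simp

theorem opF₂_selfCommutator : opF₂ * adjoint opF₂ - adjoint opF₂ * opF₂ = 0 :=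
  zero_selfCommutator

theorem opA_sub_adjoint_opB_mul_opP_apply (α : ℂ) (x : HSpace) :
    (opA α - adjoint opB * opP) x = opA α x := by
  simp [opB]

theorem opB_sub_adjoint_opA_mul_opP_apply (α : ℂ) (x : HSpace) :
    (opB - adjoint (opA α) * opP) x = 0 := by
  simp [opB, adjoint_opA_opP]

end BlockEntries

/-! ### Bilateral sequences: coordinatewise operators and the bilateral shift. -/

section BilateralSequences

section SquareSummable

variable {ι G : Type*} [NormedAddCommGroup G]

theorem hasSum_norm_sq (x : lp (fun _ : ι => G) 2) : HasSum (fun n => ‖x n‖ ^ 2) (‖x‖ ^ 2) := by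
  have h := lp.hasSum_norm (p := 2) (by norm_num) x
  simpa using h

theorem memℓp_two_of_summable {x : ι → G} (h : Summable fun n => ‖x n‖ ^ 2) :
    Memℓp (E := fun _ : ι => G) x 2 :=
  memℓp_gen (by simpa using h)

theorem norm_sq_eq_of_hasSum {x : lp (fun _ : ι => G) 2} {s : ℝ}
    (h : HasSum (fun n => ‖x n‖ ^ 2) s) : ‖x‖ ^ 2 = s :=
  (hasSum_norm_sq x).unique h

/-- The square summable sequence with given terms. -/
def ofSummable (x : ι → G) (h : Summable fun n => ‖x n‖ ^ 2) : lp (fun _ : ι => G) 2 :=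
  ⟨x, memℓp_two_of_summable h⟩

end SquareSummable

variable (G : Type*) [NormedAddCommGroup G] [InnerProductSpace ℂ G]

/-- The Hilbert space of square summable bilateral sequences in `G`. -/
abbrev BiEll2 : Type _ := lp (fun _ : ℤ => G) 2

variable {G}

omit [InnerProductSpace ℂ G] in
theorem hasSum_reindex (e : ℤ ≃ ℤ) (x : BiEll2 G) :
    HasSum (fun n => ‖x (e n)‖ ^ 2) (‖x‖ ^ 2) :=
  (Equiv.hasSum_iff (f := fun n => ‖x n‖ ^ 2) e).mpr (hasSum_norm_sq x)

/-- The unitary operator that permutes the terms of a bilateral sequence. -/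
def reindex (e : ℤ ≃ ℤ) : BiEll2 G →ₗᵢ[ℂ] BiEll2 G where
  toFun x := ofSummable (fun n => x (e n)) (hasSum_reindex e x).summable
  map_add' _ _ := rfl
  map_smul' _ _ := rfl
  norm_map' x := by
    rw [← sq_eq_sq₀ (norm_nonneg _) (norm_nonneg _)]
    exact norm_sq_eq_of_hasSum (hasSum_reindex e x)

theorem norm_sq_le_opNorm_sq_mul (T : G →L[ℂ] G) (y : G) : ‖T y‖ ^ 2 ≤ ‖T‖ ^ 2 * ‖y‖ ^ 2 := by
  rw [← mul_pow]
  exact pow_le_pow_left₀ (norm_nonneg _) (T.le_opNorm y) 2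

theorem summable_coordOp (T : G →L[ℂ] G) (x : BiEll2 G) : Summable fun n => ‖T (x n)‖ ^ 2 :=
  ((hasSum_norm_sq x).summable.mul_left (‖T‖ ^ 2)).of_nonneg_of_le (fun _ => by positivity)
    fun n => norm_sq_le_opNorm_sq_mul T (x n)

/-- The linear map on bilateral sequences that applies a given operator to each term. -/
def coordLinearMap (T : G →L[ℂ] G) : BiEll2 G →ₗ[ℂ] BiEll2 G where
  toFun x := ofSummable (fun n => T (x n)) (summable_coordOp T x)
  map_add' x y := by ext1; funext n; exact map_add T (x n) (y n)
  map_smul' c x := by ext1; funext n; exact map_smul T c (x n)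

theorem norm_coordLinearMap_le (T : G →L[ℂ] G) (x : BiEll2 G) :
    ‖coordLinearMap T x‖ ≤ ‖T‖ * ‖x‖ := by
  rw [← sq_le_sq₀ (norm_nonneg _) (by positivity), mul_pow]
  exact hasSum_le (fun n => norm_sq_le_opNorm_sq_mul T (x n)) (hasSum_norm_sq (coordLinearMap T x))
    ((hasSum_norm_sq x).mul_left _)

/-- The operator on bilateral sequences that applies a given operator to each term. -/
def coordOp (T : G →L[ℂ] G) : BiEll2 G →L[ℂ] BiEll2 G :=
  (coordLinearMap T).mkContinuous ‖T‖ (norm_coordLinearMap_le T)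

theorem coordOp_apply (T : G →L[ℂ] G) (x : BiEll2 G) (n : ℤ) : coordOp T x n = T (x n) := rfl

theorem norm_coordOp_le (T : G →L[ℂ] G) : ‖coordOp T‖ ≤ ‖T‖ :=
  LinearMap.mkContinuous_norm_le _ (norm_nonneg _) _

theorem star_coordOp [CompleteSpace G] (T : G →L[ℂ] G) :
    star (coordOp T) = coordOp (adjoint T) := by
  symm
  rw [ContinuousLinearMap.star_eq_adjoint, ContinuousLinearMap.eq_adjoint_iff]
  intro x y
  simp only [lp.inner_eq_tsum, coordOp_apply, ContinuousLinearMap.adjoint_inner_left]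

theorem coordOp_mul (S T : G →L[ℂ] G) : coordOp S * coordOp T = coordOp (S * T) := rfl

theorem coordOp_add (S T : G →L[ℂ] G) : coordOp S + coordOp T = coordOp (S + T) := rfl

theorem coordOp_zero : coordOp (0 : G →L[ℂ] G) = 0 := rfl

/-- The bilateral shift. -/
def biShift : BiEll2 G →L[ℂ] BiEll2 G :=
  (reindex (Equiv.subRight 1)).toContinuousLinearMap

theorem norm_biShift_apply (x : BiEll2 G) : ‖biShift x‖ = ‖x‖ :=
  (reindex (Equiv.subRight 1)).norm_map x

theorem biShift_mem_unitary [CompleteSpace G] :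
    biShift ∈ unitary (BiEll2 G →L[ℂ] BiEll2 G) := by
  have h1 : star (biShift : BiEll2 G →L[ℂ] BiEll2 G) * biShift = 1 :=
    (ContinuousLinearMap.norm_map_iff_adjoint_comp_self _).mp norm_biShift_apply
  -- The backward shift is a right inverse; it must agree with the left inverse `star biShift`, so
  -- the isometry is unitary.
  have h2 : (biShift : BiEll2 G →L[ℂ] BiEll2 G)
      * (reindex (Equiv.addRight 1)).toContinuousLinearMap = 1 := by
    ext1 x
    ext1
    funext n
    exact congrArg x (sub_add_cancel n 1)
  rw [Unitary.mem_iff]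
  refine ⟨h1, ?_⟩
  rwa [left_inv_eq_right_inv h1 h2]

theorem coordOp_commute_biShift (T : G →L[ℂ] G) : Commute (coordOp T) biShift := by
  ext1 x
  ext1
  rfl

theorem star_coordOp_commute_biShift [CompleteSpace G] (T : G →L[ℂ] G) :
    Commute (star (coordOp T)) biShift := by
  rw [star_coordOp]
  exact coordOp_commute_biShift _

/-- The restriction of a bilateral sequence to the nonnegative indices, as a linear map. -/
def nonnegPartLinearMap : BiEll2 G →ₗ[ℂ] Ell2 G where
  toFun x := ofSummable (fun n : ℕ => x (n : ℤ))
    ((hasSum_norm_sq x).summable.comp_injective Nat.cast_injective)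
  map_add' _ _ := rfl
  map_smul' _ _ := rfl

theorem norm_nonnegPartLinearMap_le (x : BiEll2 G) : ‖nonnegPartLinearMap x‖ ≤ 1 * ‖x‖ := by
  rw [one_mul, ← sq_le_sq₀ (norm_nonneg _) (norm_nonneg _)]
  have h1 : HasSum (fun n : ℕ => ‖x (n : ℤ)‖ ^ 2) (‖nonnegPartLinearMap x‖ ^ 2) :=
    hasSum_norm_sq (nonnegPartLinearMap x)
  have h2 : HasSum (fun n : ℤ => ‖x n‖ ^ 2) (‖x‖ ^ 2) := hasSum_norm_sq x
  generalize ‖nonnegPartLinearMap x‖ ^ 2 = a at h1 ⊢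
  generalize ‖x‖ ^ 2 = b at h2 ⊢
  generalize hf : (fun n : ℤ => ‖x n‖ ^ 2) = f at h2
  have h0 : ∀ n, 0 ≤ f n := fun n => hf ▸ sq_nonneg _
  have h3 : HasSum (fun n : ℕ => f (n : ℤ)) a := by rw [← hf]; exact h1
  exact hasSum_le_inj (fun n : ℕ => (n : ℤ)) Nat.cast_injective (fun n _ => h0 n)
    (fun _ => le_rfl) h3 h2

/-- The restriction of a bilateral sequence to the nonnegative indices. -/
def nonnegPart : BiEll2 G →L[ℂ] Ell2 G :=
  nonnegPartLinearMap.mkContinuous 1 norm_nonnegPartLinearMap_le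

end BilateralSequences

/-! ### The algebra of the pencil `F + F^* U` for a unitary `U` commuting with `F` and `F^*`. -/

section Pencil

variable {A : Type*} [NormedRing A] [StarRing A]

/-- The triple `(F + F^* U, F U + F^* U², U²)`. -/
def pencilTriple (U F : A) : Fin 3 → A :=
  ![F + star F * U, U * (F + star F * U), U * U]

theorem pencil_commute {U F : A} (hFU : Commute F U) (hFU' : Commute (star F) U) :
    Commute (F + star F * U) U :=
  hFU.add_left (hFU'.mul_left (Commute.refl U))

variable {U F : A}

theorem pencil_commute_star (hU : U ∈ unitary A) (hFU : Commute F U)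
    (hFU' : Commute (star F) U) : Commute (F + star F * U) (star U) := by
  have h1 : Commute F (star U) := by simpa using hFU'.star_star
  have h2 : Commute (star F) (star U) := hFU.star_star
  have h3 : Commute U (star U) :=
    (Unitary.mul_star_self_of_mem hU).trans (Unitary.star_mul_self_of_mem hU).symm
  exact h1.add_left (h2.mul_left h3)

/-- Taking adjoints only multiplies the pencil by `U^*`. Its normality, the relation `N₁ = N₂^* N₃`
and the norm estimate all rest on this. -/
theorem star_pencil (hU : U ∈ unitary A) (hFU' : Commute (star F) U) :
    star (F + star F * U) = star U * (F + star F * U) := by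
  have h1 : Commute F (star U) := by simpa using hFU'.star_star
  rw [star_add, star_mul, star_star, hFU'.eq, mul_add, ← mul_assoc,
    Unitary.star_mul_self_of_mem hU, one_mul, add_comm]

theorem isStarNormal_pencil (hU : U ∈ unitary A) (hFU : Commute F U)
    (hFU' : Commute (star F) U) : IsStarNormal (F + star F * U) := by
  refine ⟨?_⟩
  rw [star_pencil hU hFU']
  exact (pencil_commute_star hU hFU hFU').symm.mul_left (Commute.refl _)

theorem isStarNormal_mul_pencil (hU : U ∈ unitary A) (hFU : Commute F U)
    (hFU' : Commute (star F) U) : IsStarNormal (U * (F + star F * U)) := by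
  have h3 : Commute (star U) U :=
    (Unitary.star_mul_self_of_mem hU).trans (Unitary.mul_star_self_of_mem hU).symm
  have h4 := pencil_commute_star hU hFU hFU'
  have h5 := pencil_commute hFU hFU'
  refine ⟨?_⟩
  rw [star_mul, star_pencil hU hFU']
  refine Commute.mul_left (Commute.mul_left ?_ ?_) ?_
  · exact h3.mul_right h4.symm
  · exact h5.mul_right (Commute.refl _)
  · exact h3.mul_right h4.symm

theorem pencilTriple_zero_eq (hU : U ∈ unitary A) (hFU : Commute F U)
    (hFU' : Commute (star F) U) :
    pencilTriple U F 0 = star (pencilTriple U F 1) * pencilTriple U F 2 := by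
  have h4 := pencil_commute_star hU hFU hFU'
  change F + star F * U = star (U * (F + star F * U)) * (U * U)
  rw [star_mul, star_pencil hU hFU', ← h4.eq, mul_assoc, ← mul_assoc (star U) U,
    Unitary.star_mul_self_of_mem hU, one_mul, mul_assoc, Unitary.star_mul_self_of_mem hU, mul_one]

theorem pencilTriple_commute (hFU : Commute F U) (hFU' : Commute (star F) U) (i j : Fin 3) :
    Commute (pencilTriple U F i) (pencilTriple U F j) := by
  have h5 := pencil_commute hFU hFU'
  have key : ∀ i, Commute (pencilTriple U F i) (F + star F * U) ∧
      Commute (pencilTriple U F i) U := by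
    intro i
    fin_cases i
    · exact ⟨Commute.refl _, h5⟩
    · exact ⟨h5.symm.mul_left (Commute.refl _), (Commute.refl U).mul_left h5⟩
    · exact ⟨h5.symm.mul_left h5.symm, (Commute.refl U).mul_left (Commute.refl U)⟩
  obtain ⟨h1, h2⟩ := key i
  fin_cases j
  · exact h1
  · exact h2.mul_right h1
  · exact h2.mul_right h2

theorem pencilTriple_normal (hU : U ∈ unitary A) (hFU : Commute F U)
    (hFU' : Commute (star F) U) (i : Fin 3) : IsStarNormal (pencilTriple U F i) := by
  fin_cases i
  · exact isStarNormal_pencil hU hFU hFU'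
  · exact isStarNormal_mul_pencil hU hFU hFU'
  · have h := mul_mem hU hU
    exact ⟨(Unitary.star_mul_self_of_mem h).trans (Unitary.mul_star_self_of_mem h).symm⟩

/-- For `p = F + F^* U`, `p^* p = U^* p²`; as `F²` and `F^*²` vanish, only the cross terms `U (F F^*
+ F^* F)` of `p²` survive. -/
theorem norm_pencil_sq_le [CStarRing A] (hU : U ∈ unitary A)
    (hFU : Commute F U) (hFU' : Commute (star F) U) (hF : F * F = 0) :
    ‖F + star F * U‖ ^ 2 ≤ ‖F * star F + star F * F‖ := by
  have hF' : star F * star F = 0 := by rw [← star_mul, hF, star_zero]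
  have h1 : star (F + star F * U) * (F + star F * U) = F * star F + star F * F := by
    rw [star_pencil hU hFU', mul_assoc]
    have h2 : (F + star F * U) * (F + star F * U) = U * (F * star F + star F * F) := by
      have h3 : star F * U * (star F * U) = 0 := by
        rw [mul_assoc, ← mul_assoc U, ← hFU'.eq, mul_assoc, ← mul_assoc, hF', zero_mul]
      have h4 : F * (star F * U) = U * (F * star F) := by
        rw [← mul_assoc, (hFU.mul_left hFU').eq]
      have h5 : star F * U * F = U * (star F * F) := by rw [hFU'.eq, mul_assoc]
      rw [mul_add, add_mul, add_mul, hF, h3, h4, h5, zero_add, add_zero, mul_add, add_comm]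
    rw [h2, ← mul_assoc, Unitary.star_mul_self_of_mem hU, one_mul]
  rw [sq, ← CStarRing.norm_star_mul_self, h1]

end Pencil

/-! ### The pencil triple on bilateral sequences is a tetrablock unitary. -/

section BilateralPencil

variable {G : Type*} [NormedAddCommGroup G] [InnerProductSpace ℂ G] [CompleteSpace G]

/-- The triple `(F + F^* U, F U + F^* U², U²)` on bilateral sequences, where `F` acts on each term
and `U` is the bilateral shift. -/
def biTriple (F : G →L[ℂ] G) : Fin 3 → (BiEll2 G →L[ℂ] BiEll2 G) :=
  pencilTriple biShift (coordOp F)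

variable {F : G →L[ℂ] G} {c : ℝ}

theorem norm_biTriple_zero_le (hF : F * F = 0) (hc : 0 ≤ c)
    (h : ∀ y, ‖F (adjoint F y) + adjoint F (F y)‖ ≤ c ^ 2 * ‖y‖) : ‖biTriple F 0‖ ≤ c := by
  have h1 : ‖biTriple F 0‖ ^ 2
      ≤ ‖coordOp F * star (coordOp F) + star (coordOp F) * coordOp F‖ :=
    norm_pencil_sq_le biShift_mem_unitary (coordOp_commute_biShift _)
      (star_coordOp_commute_biShift _) (by rw [coordOp_mul, hF, coordOp_zero])
  rw [star_coordOp, coordOp_mul, coordOp_mul, coordOp_add] at h1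
  refine (sq_le_sq₀ (norm_nonneg (biTriple F 0)) hc).mp (h1.trans ((norm_coordOp_le _).trans ?_))
  exact ContinuousLinearMap.opNorm_le_bound _ (by positivity) h

theorem norm_biTriple_one_le (hF : F * F = 0) (hc : 0 ≤ c)
    (h : ∀ y, ‖F (adjoint F y) + adjoint F (F y)‖ ≤ c ^ 2 * ‖y‖) : ‖biTriple F 1‖ ≤ c :=
  ContinuousLinearMap.opNorm_le_bound _ hc fun x =>
    (norm_biShift_apply (biTriple F 0 x)).trans_le
      ((biTriple F 0).le_of_opNorm_le (norm_biTriple_zero_le hF hc h) x)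

variable (F)

theorem biTriple_zero_eq : biTriple F 0 = adjoint (biTriple F 1) * biTriple F 2 :=
  pencilTriple_zero_eq biShift_mem_unitary (coordOp_commute_biShift _)
    (star_coordOp_commute_biShift _)

theorem biTriple_commute (i j : Fin 3) : Commute (biTriple F i) (biTriple F j) :=
  pencilTriple_commute (coordOp_commute_biShift _) (star_coordOp_commute_biShift _) i j

theorem norm_biTriple_two_apply (x : BiEll2 G) : ‖biTriple F 2 x‖ = ‖x‖ :=
  (norm_biShift_apply (biShift x)).trans (norm_biShift_apply x)

theorem biTriple_zero_apply (x : BiEll2 G) (n : ℤ) :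
    biTriple F 0 x n = adjoint F (x (n - 1)) + F (x n) := by
  have h : biTriple F 0 = star (coordOp F) * biShift + coordOp F :=
    add_comm (coordOp F) (star (coordOp F) * biShift)
  rw [h, star_coordOp]
  rfl

theorem biTriple_one_apply (x : BiEll2 G) (n : ℤ) :
    biTriple F 1 x n = adjoint F (x (n - 1 - 1)) + F (x (n - 1)) :=
  biTriple_zero_apply F x (n - 1)

theorem biTriple_two_apply (x : BiEll2 G) (n : ℤ) : biTriple F 2 x n = x (n - 1 - 1) := rfl

variable {F}

theorem isTetrablockUnitary_biTriple (hF : F * F = 0)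
    (h : ∀ y, ‖F (adjoint F y) + adjoint F (F y)‖ ≤ 1 ^ 2 * ‖y‖) :
    IsTetrablockUnitary (biTriple F) :=
  isTetrablockUnitary_of_unitary (biTriple_commute F)
    (pencilTriple_normal biShift_mem_unitary (coordOp_commute_biShift _)
      (star_coordOp_commute_biShift _))
    (biTriple_zero_eq F) (norm_biTriple_one_le hF zero_le_one h)
    (norm_biTriple_two_apply F)

end BilateralPencil

/-! ### The embedding of `H ⊕ ℓ²(G)` and its invariance under the pencil triple. -/

section BilateralEmbedding

variable {H G : Type*} [NormedAddCommGroup H] [InnerProductSpace ℂ H] [NormedAddCommGroup G]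
  [InnerProductSpace ℂ G]

theorem hasSum_int_of_eventually_zero {f : ℤ → ℝ} {a : ℝ} (h : HasSum (fun n : ℕ => f n) a)
    (h0 : ∀ n ≤ -4, f n = 0) : HasSum f (a + (f (-1) + f (-2) + f (-3))) := by
  have h1 : HasSum (fun n : ℕ => f (-(n + 1 : ℤ)))
      (∑ n ∈ Finset.range 3, f (-((n : ℤ) + 1))) := by
    refine hasSum_sum_of_ne_finset_zero fun n hn => h0 _ ?_
    have hn' : 3 ≤ n := by simpa using hn
    omega
  have h2 := h.of_nat_of_neg_add_one h1
  norm_num [Finset.sum_range_succ] at h2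
  exact h2

/-- The bilateral sequence `(…, 0, Q h, 0, D h, x₀, x₁, …)`, with `x₀` at the index `0`, that
represents an element `(h, x₀, x₁, …)` of `H ⊕ ℓ²(G)`. -/
def biSeq (D Q : H →L[ℂ] G) (k : WithLp 2 (H × Ell2 G)) : ℤ → G
  | Int.ofNat n => k.snd n
  | Int.negSucc 0 => D k.fst
  | Int.negSucc 1 => 0
  | Int.negSucc 2 => Q k.fst
  | Int.negSucc (_ + 3) => 0

variable (D Q : H →L[ℂ] G)

theorem biSeq_natCast (k : WithLp 2 (H × Ell2 G)) (n : ℕ) : biSeq D Q k n = k.snd n := rfl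

theorem biSeq_neg_one (k : WithLp 2 (H × Ell2 G)) : biSeq D Q k (-1) = D k.fst := rfl

theorem biSeq_neg_two (k : WithLp 2 (H × Ell2 G)) : biSeq D Q k (-2) = 0 := rfl

theorem biSeq_neg_three (k : WithLp 2 (H × Ell2 G)) : biSeq D Q k (-3) = Q k.fst := rfl

theorem biSeq_of_le (k : WithLp 2 (H × Ell2 G)) {n : ℤ} (hn : n ≤ -4) : biSeq D Q k n = 0 := by
  obtain ⟨m, rfl⟩ : ∃ m : ℕ, n = Int.negSucc (m + 3) := ⟨(-4 - n).toNat, by omega⟩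
  rfl

theorem biSeq_add (x y : WithLp 2 (H × Ell2 G)) (n : ℤ) :
    biSeq D Q (x + y) n = biSeq D Q x n + biSeq D Q y n := by
  rcases n with n | _ | _ | _ | n
  · rfl
  · exact map_add D x.fst y.fst
  · exact (add_zero (0 : G)).symm
  · exact map_add Q x.fst y.fst
  · exact (add_zero (0 : G)).symm

theorem biSeq_smul (c : ℂ) (x : WithLp 2 (H × Ell2 G)) (n : ℤ) :
    biSeq D Q (c • x) n = c • biSeq D Q x n := by
  rcases n with n | _ | _ | _ | n
  · rfl
  · exact map_smul D c x.fst
  · exact (smul_zero c).symm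
  · exact map_smul Q c x.fst
  · exact (smul_zero c).symm

variable {D Q}

theorem hasSum_norm_biSeq (hDQ : ∀ h, ‖Q h‖ ^ 2 + ‖D h‖ ^ 2 = ‖h‖ ^ 2)
    (k : WithLp 2 (H × Ell2 G)) : HasSum (fun n => ‖biSeq D Q k n‖ ^ 2) (‖k‖ ^ 2) := by
  have h1 : HasSum (fun n : ℕ => ‖biSeq D Q k n‖ ^ 2) (‖k.snd‖ ^ 2) := by
    have h := hasSum_norm_sq k.snd
    simpa only [biSeq_natCast] using h
  have h2 := hasSum_int_of_eventually_zero (f := fun n => ‖biSeq D Q k n‖ ^ 2) h1 fun n hn => by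
    rw [biSeq_of_le D Q k hn, norm_zero, zero_pow two_ne_zero]
  rw [biSeq_neg_one, biSeq_neg_two, biSeq_neg_three] at h2
  have h3 : ‖k.snd‖ ^ 2 + (‖D k.fst‖ ^ 2 + ‖(0 : G)‖ ^ 2 + ‖Q k.fst‖ ^ 2) = ‖k‖ ^ 2 := by
    rw [WithLp.prod_norm_sq_eq_of_L2 k, ← hDQ, norm_zero]
    ring
  rwa [h3] at h2

/-- The embedding of `H ⊕ ℓ²(G)` into the space of bilateral sequences in `G`. -/
def biEmbed (hDQ : ∀ h, ‖Q h‖ ^ 2 + ‖D h‖ ^ 2 = ‖h‖ ^ 2) :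
    WithLp 2 (H × Ell2 G) →ₗᵢ[ℂ] BiEll2 G where
  toFun k := ofSummable (biSeq D Q k) (hasSum_norm_biSeq hDQ k).summable
  map_add' x y := by ext1; funext n; exact biSeq_add D Q x y n
  map_smul' c x := by ext1; funext n; exact biSeq_smul D Q c x n
  norm_map' k := by
    rw [← sq_eq_sq₀ (norm_nonneg _) (norm_nonneg _)]
    exact norm_sq_eq_of_hasSum (hasSum_norm_biSeq hDQ k)

variable (hDQ : ∀ h, ‖Q h‖ ^ 2 + ‖D h‖ ^ 2 = ‖h‖ ^ 2)

theorem biEmbed_apply (k : WithLp 2 (H × Ell2 G)) (n : ℤ) :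
    biEmbed hDQ k n = biSeq D Q k n := rfl

/-- The compression to `H ⊕ ℓ²(G)` of an operator on bilateral sequences, with the `H`-component
replaced by a given operator on `H`. -/
def biRestrict (S : H →L[ℂ] H) (N : BiEll2 G →L[ℂ] BiEll2 G) :
    WithLp 2 (H × Ell2 G) →L[ℂ] WithLp 2 (H × Ell2 G) :=
  ((WithLp.prodContinuousLinearEquiv 2 ℂ H (Ell2 G)).symm :
      H × Ell2 G →L[ℂ] WithLp 2 (H × Ell2 G)) ∘L
    (S ∘L WithLp.fstL 2 ℂ H (Ell2 G)).prod
      (nonnegPart ∘L N ∘L (biEmbed hDQ).toContinuousLinearMap)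

theorem biRestrict_fst (S : H →L[ℂ] H) (N : BiEll2 G →L[ℂ] BiEll2 G)
    (k : WithLp 2 (H × Ell2 G)) : (biRestrict hDQ S N k).fst = S k.fst := rfl

theorem biRestrict_snd_apply (S : H →L[ℂ] H) (N : BiEll2 G →L[ℂ] BiEll2 G)
    (k : WithLp 2 (H × Ell2 G)) (n : ℕ) :
    (biRestrict hDQ S N k).snd n = N (biEmbed hDQ k) n := rfl

/-- The nonnegative entries agree by construction of `biRestrict`, so invariance is a condition on
the negative entries alone. -/
theorem biEmbed_biRestrict {S : H →L[ℂ] H} {N : BiEll2 G →L[ℂ] BiEll2 G}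
    {k : WithLp 2 (H × Ell2 G)} (h1 : N (biEmbed hDQ k) (-1) = D (S k.fst))
    (h2 : N (biEmbed hDQ k) (-2) = 0) (h3 : N (biEmbed hDQ k) (-3) = Q (S k.fst))
    (h4 : ∀ n ≤ -4, N (biEmbed hDQ k) n = 0) :
    N (biEmbed hDQ k) = biEmbed hDQ (biRestrict hDQ S N k) := by
  ext1; funext n
  rcases n with n | _ | _ | _ | n
  · rfl
  · exact h1
  · exact h2
  · exact h3
  · exact h4 _ (by omega)

variable [CompleteSpace G] {F : G →L[ℂ] G} {A P : H →L[ℂ] H}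

/-- `F` and `F^*` kill the entry `Q h`, so nothing new appears at `-2` or `-3`; at `-1` only `F D h
= D A h` is left. -/
theorem biTriple_zero_biEmbed (hFQ : ∀ h, F (Q h) = 0) (hFQ' : ∀ h, adjoint F (Q h) = 0)
    (hDA : ∀ h, D (A h) = F (D h)) (hQA : ∀ h, Q (A h) = 0) (k : WithLp 2 (H × Ell2 G)) :
    biTriple F 0 (biEmbed hDQ k) = biEmbed hDQ (biRestrict hDQ A (biTriple F 0) k) := by
  apply biEmbed_biRestrict
  · rw [biTriple_zero_apply, biEmbed_apply, biEmbed_apply, biSeq_neg_one, hDA]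
    exact add_eq_right.mpr (map_zero _)
  · rw [biTriple_zero_apply, biEmbed_apply, biEmbed_apply, biSeq_neg_two, map_zero, add_zero]
    exact hFQ' _
  · rw [biTriple_zero_apply, biEmbed_apply, biEmbed_apply, biSeq_neg_three, hFQ, hQA, add_zero,
      biSeq_of_le D Q k (by omega), map_zero]
  · intro n hn
    rw [biTriple_zero_apply, biEmbed_apply, biEmbed_apply, biSeq_of_le D Q k (by omega),
      biSeq_of_le D Q k hn, map_zero, map_zero, add_zero]

theorem biTriple_one_biEmbed (hFQ : ∀ h, F (Q h) = 0) (hFQ' : ∀ h, adjoint F (Q h) = 0)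
    (k : WithLp 2 (H × Ell2 G)) :
    biTriple F 1 (biEmbed hDQ k) = biEmbed hDQ (biRestrict hDQ 0 (biTriple F 1) k) := by
  apply biEmbed_biRestrict
  · rw [biTriple_one_apply, biEmbed_apply, biEmbed_apply, zero_apply, map_zero]
    exact (congrArg₂ (· + ·) (hFQ' k.fst) (map_zero F)).trans (add_zero 0)
  · rw [biTriple_one_apply, biEmbed_apply, biEmbed_apply, biSeq_of_le D Q k (by omega), map_zero,
      zero_add]
    exact hFQ _
  · rw [biTriple_one_apply, biEmbed_apply, biEmbed_apply, biSeq_of_le D Q k (by omega),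
      biSeq_of_le D Q k (by omega), zero_apply, map_zero, map_zero, map_zero, add_zero]
  · intro n hn
    rw [biTriple_one_apply, biEmbed_apply, biEmbed_apply, biSeq_of_le D Q k (by omega),
      biSeq_of_le D Q k (by omega), map_zero, map_zero, add_zero]

/-- The entries `Q h` and `D h` sit two places apart, so the double shift moves `Q h = D (P h)` to
the place `-1`, and the gap at `-2` becomes the zero at place `0`. -/
theorem biTriple_two_biEmbed (hDP : ∀ h, D (P h) = Q h) (hQP : ∀ h, Q (P h) = 0)
    (k : WithLp 2 (H × Ell2 G)) :
    biTriple F 2 (biEmbed hDQ k) = biEmbed hDQ (biRestrict hDQ P (biTriple F 2) k) := by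
  apply biEmbed_biRestrict
  · rw [biTriple_two_apply, biEmbed_apply, hDP]
    exact biSeq_neg_three D Q k
  · rw [biTriple_two_apply, biEmbed_apply, biSeq_of_le D Q k (by omega)]
  · rw [biTriple_two_apply, biEmbed_apply, biSeq_of_le D Q k (by omega), hQP]
  · intro n hn
    rw [biTriple_two_apply, biEmbed_apply, biSeq_of_le D Q k (by omega)]

end BilateralEmbedding

/-! ### Properties inherited by restriction to an invariant subspace. -/

section Restriction

universe u

variable {K M : Type u} [NormedAddCommGroup K] [InnerProductSpace ℂ K]
  [NormedAddCommGroup M] [InnerProductSpace ℂ M] {J : K →ₗᵢ[ℂ] M}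

theorem commute_of_intertwine {V W : K →L[ℂ] K} {N R : M →L[ℂ] M}
    (hV : ∀ k, N (J k) = J (V k)) (hW : ∀ k, R (J k) = J (W k)) (h : Commute N R) :
    Commute V W := by
  ext1 k
  apply J.injective
  rw [mul_apply_eq_comp, mul_apply_eq_comp, ← hV, ← hW, ← hW, ← hV]
  exact congrArg (fun f : M →L[ℂ] M => f (J k)) h.eq

theorem isometry_of_intertwine {V : K →L[ℂ] K} {N : M →L[ℂ] M} (hV : ∀ k, N (J k) = J (V k))
    (h : ∀ x, ‖N x‖ = ‖x‖) : Isometry V :=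
  AddMonoidHomClass.isometry_of_norm _ fun k => by
    rw [← J.norm_map, ← hV, h, J.norm_map]

theorem norm_le_of_intertwine {V : K →L[ℂ] K} {N : M →L[ℂ] M}
    (hV : ∀ k, N (J k) = J (V k)) : ‖V‖ ≤ ‖N‖ :=
  ContinuousLinearMap.opNorm_le_bound _ (norm_nonneg N) fun k => by
    rw [← J.norm_map, ← hV, ← J.norm_map k]
    exact N.le_opNorm _

/-- The relation passes to a merely invariant subspace because, tested on inner products, it reads
`⟪V₁ x, y⟫ = ⟪V₃ x, V₂ y⟫`, with no adjoint left. -/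
theorem eq_adjoint_mul_of_intertwine [CompleteSpace K] [CompleteSpace M]
    {V : Fin 3 → (K →L[ℂ] K)} {N : Fin 3 → (M →L[ℂ] M)}
    (hV : ∀ i k, N i (J k) = J (V i k)) (h : N 0 = adjoint (N 1) * N 2) :
    V 0 = adjoint (V 1) * V 2 := by
  ext1 x
  refine ext_inner_right ℂ fun y => ?_
  rw [mul_apply_eq_comp, ContinuousLinearMap.adjoint_inner_left, ← J.inner_map_map,
    ← J.inner_map_map (V 2 x), ← hV, ← hV, ← hV, h, mul_apply_eq_comp,
    ContinuousLinearMap.adjoint_inner_left]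

end Restriction

/-! ### The dilation of `(A_α, 0, P)` and its explicit form. -/

section Dilation

/-- The operator `P` as an operator from `ℋ` to `𝒟_P`. -/
def opPTo : HSpace →L[ℂ] DP := opP.codRestrict DP opP_mem_DP

theorem coe_opPTo (h : HSpace) : (opPTo h : HSpace) = opP h := rfl

theorem norm_sq_opPTo_add_defectTo (h : HSpace) :
    ‖opPTo h‖ ^ 2 + ‖defectTo opP h‖ ^ 2 = ‖h‖ ^ 2 := by
  rw [Submodule.coe_norm, Submodule.coe_norm, coe_opPTo, coe_defectTo_opP,
    norm_sq_opP_add_lastTwo]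

theorem opF₁_opPTo (α : ℂ) (h : HSpace) : opF₁ α (opPTo h) = 0 :=
  Subtype.ext ((coe_opF₁ α _).trans (opA_opP α h))

theorem adjoint_opF₁_opPTo (α : ℂ) (h : HSpace) : adjoint (opF₁ α) (opPTo h) = 0 :=
  Subtype.ext ((coe_adjoint_opF₁ α _).trans (adjoint_opA_opP α h))

theorem defectTo_opA (α : ℂ) (h : HSpace) :
    defectTo opP (opA α h) = opF₁ α (defectTo opP h) :=
  Subtype.ext (by rw [coe_defectTo_opP, opF₁_defectTo, (mem_DP_iff _).mp (opA_mem_DP α h)])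

theorem defectTo_opP_opP (h : HSpace) : defectTo opP (opP h) = opPTo h :=
  Subtype.ext (by rw [coe_defectTo_opP, (mem_DP_iff _).mp (opP_mem_DP h), coe_opPTo])

theorem opPTo_opA (α : ℂ) (h : HSpace) : opPTo (opA α h) = 0 := Subtype.ext (opP_opA α h)

theorem opPTo_opP (h : HSpace) : opPTo (opP h) = 0 := Subtype.ext (opP_opP h)

/-- The embedding of `𝒦` into the space of bilateral sequences in `𝒟_P`. -/
def embed : KSpace →ₗᵢ[ℂ] BiEll2 DP := biEmbed norm_sq_opPTo_add_defectTo

/-- The dilation of `(A_α, 0, P)`. -/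
def dilation (α : ℂ) (i : Fin 3) : KSpace →L[ℂ] KSpace :=
  biRestrict norm_sq_opPTo_add_defectTo (triple α i) (biTriple (opF₁ α) i)

theorem dilation_fst (α : ℂ) (i : Fin 3) (k : KSpace) :
    (dilation α i k).fst = triple α i k.fst :=
  biRestrict_fst norm_sq_opPTo_add_defectTo _ _ k

theorem dilation_snd_apply (α : ℂ) (i : Fin 3) (k : KSpace) (n : ℕ) :
    (dilation α i k).snd n = biTriple (opF₁ α) i (embed k) n :=
  biRestrict_snd_apply norm_sq_opPTo_add_defectTo _ _ k n

theorem embed_natCast (k : KSpace) (n : ℕ) : embed k n = k.snd n :=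
  biSeq_natCast (defectTo opP) opPTo k n

theorem embed_neg_one (k : KSpace) : embed k (-1) = defectTo opP k.fst :=
  biSeq_neg_one (defectTo opP) opPTo k

theorem embed_neg_two (k : KSpace) : embed k (-2) = 0 :=
  biSeq_neg_two (defectTo opP) opPTo k

theorem biTriple_embed (α : ℂ) (i : Fin 3) (k : KSpace) :
    biTriple (opF₁ α) i (embed k) = embed (dilation α i k) := by
  fin_cases i
  · exact biTriple_zero_biEmbed norm_sq_opPTo_add_defectTo (opF₁_opPTo α)
      (adjoint_opF₁_opPTo α) (defectTo_opA α) (opPTo_opA α) k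
  · exact biTriple_one_biEmbed norm_sq_opPTo_add_defectTo (opF₁_opPTo α)
      (adjoint_opF₁_opPTo α) k
  · exact biTriple_two_biEmbed norm_sq_opPTo_add_defectTo defectTo_opP_opP opPTo_opP k

theorem dilation_commute (α : ℂ) (i j : Fin 3) : Commute (dilation α i) (dilation α j) :=
  commute_of_intertwine (biTriple_embed α i) (biTriple_embed α j) (biTriple_commute _ i j)

theorem isometry_dilation_two (α : ℂ) : Isometry (dilation α 2) :=
  isometry_of_intertwine (biTriple_embed α 2) (norm_biTriple_two_apply _)

theorem dilation_zero_eq (α : ℂ) : dilation α 0 = adjoint (dilation α 1) * dilation α 2 :=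
  eq_adjoint_mul_of_intertwine (biTriple_embed α) (biTriple_zero_eq _)

theorem norm_le_norm_dilation_zero (α : ℂ) : ‖α‖ ≤ ‖dilation α 0‖ := by
  have h1 := (dilation α 0).le_opNorm (inclH cyclicVector)
  rw [inclH.norm_map, norm_cyclicVector, mul_one] at h1
  refine le_trans ?_ h1
  have h2 : ‖(dilation α 0 (inclH cyclicVector)).fst‖ ≤ ‖dilation α 0 (inclH cyclicVector)‖ :=
    WithLp.norm_fst_le _ _
  rw [dilation_fst] at h2
  exact (norm_opA_cyclicVector α).symm.trans_le h2

theorem norm_dilation_zero (α : ℂ) : ‖dilation α 0‖ = ‖α‖ :=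
  le_antisymm ((norm_le_of_intertwine (biTriple_embed α 0)).trans
    (norm_biTriple_zero_le (opF₁_mul_self α) (norm_nonneg _) (norm_opF₁_mul_adjoint_add_le α)))
    (norm_le_norm_dilation_zero α)

theorem norm_dilation_one (α : ℂ) : ‖dilation α 1‖ = ‖α‖ := by
  refine le_antisymm ((norm_le_of_intertwine (biTriple_embed α 1)).trans
    (norm_biTriple_one_le (opF₁_mul_self α) (norm_nonneg _) (norm_opF₁_mul_adjoint_add_le α))) ?_
  have h1 : ‖dilation α 2‖ ≤ 1 :=
    ContinuousLinearMap.opNorm_le_bound _ zero_le_one fun k => by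
      rw [one_mul, (isometry_dilation_two α).norm_map_of_map_zero (map_zero _)]
  -- The lower bound comes from `V₁ = V₂^* V₃`: `|α| = ‖V₁‖ ≤ ‖V₂‖ ‖V₃‖ ≤ ‖V₂‖`.
  have h2 := norm_mul_le (adjoint (dilation α 1)) (dilation α 2)
  rw [← dilation_zero_eq, norm_dilation_zero, LinearIsometryEquiv.norm_map] at h2
  exact h2.trans (mul_le_of_le_one_right (norm_nonneg _) h1)

theorem inner_inclH (g : HSpace) (k : KSpace) : ⟪inclH g, k⟫_ℂ = ⟪g, k.fst⟫_ℂ := by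
  have h : ⟪inclH g, k⟫_ℂ = ⟪g, k.fst⟫_ℂ + ⟪(0 : Ell2 DP), k.snd⟫_ℂ :=
    WithLp.prod_inner_apply _ _
  rw [h, inner_zero_left, add_zero]

theorem isTetrablockIsometricDilation_dilation {α : ℂ} (hα : ‖α‖ ≤ 1) :
    IsTetrablockIsometricDilation inclH (triple α) (dilation α) where
  isometry := ⟨BiEll2 DP, inferInstance, inferInstance, inferInstance, biTriple (opF₁ α), embed,
    isTetrablockUnitary_biTriple (opF₁_mul_self α) fun y =>
      (norm_opF₁_mul_adjoint_add_le α y).trans (by gcongr), biTriple_embed α⟩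
  adjoint_restrict i h := by
    -- The `ℋ`-component of `Vᵢ k` depends only on that of `k`; dually, `Vᵢ^*` leaves `ℋ` invariant.
    refine ext_inner_right ℂ fun k => ?_
    rw [ContinuousLinearMap.adjoint_inner_left, inner_inclH, inner_inclH,
      ContinuousLinearMap.adjoint_inner_left, dilation_fst]

theorem dilation_zero_snd_zero (α : ℂ) (k : KSpace) :
    (dilation α 0 k).snd 0 = adjoint (opF₁ α) (defectTo opP k.fst) + opF₁ α (k.snd 0) := by
  rw [dilation_snd_apply, biTriple_zero_apply, show ((0 : ℕ) : ℤ) - 1 = -1 by norm_num]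
  exact congrArg₂ (fun a b => adjoint (opF₁ α) a + opF₁ α b) (embed_neg_one k) (embed_natCast k 0)

theorem dilation_zero_snd_succ (α : ℂ) (k : KSpace) (n : ℕ) :
    (dilation α 0 k).snd (n + 1)
      = adjoint (opF₁ α) (k.snd n) + opF₁ α (k.snd (n + 1)) := by
  rw [dilation_snd_apply, biTriple_zero_apply,
    show ((n + 1 : ℕ) : ℤ) - 1 = (n : ℕ) by push_cast; ring]
  exact congrArg₂ (fun a b => adjoint (opF₁ α) a + opF₁ α b) (embed_natCast k n)
    (embed_natCast k (n + 1))

theorem dilation_one_snd_zero (α : ℂ) (k : KSpace) :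
    (dilation α 1 k).snd 0 = opF₁ α (defectTo opP k.fst) := by
  rw [dilation_snd_apply, biTriple_one_apply, show ((0 : ℕ) : ℤ) - 1 = -1 by norm_num,
    show (-1 : ℤ) - 1 = -2 by norm_num]
  refine (congrArg₂ (fun a b => adjoint (opF₁ α) a + opF₁ α b) (embed_neg_two k)
    (embed_neg_one k)).trans ?_
  simp only [map_zero, zero_add]

theorem dilation_one_snd_one (α : ℂ) (k : KSpace) :
    (dilation α 1 k).snd 1 = adjoint (opF₁ α) (defectTo opP k.fst) + opF₁ α (k.snd 0) := by
  rw [dilation_snd_apply, biTriple_one_apply, show ((1 : ℕ) : ℤ) - 1 = (0 : ℕ) by norm_num,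
    show ((0 : ℕ) : ℤ) - 1 = -1 by norm_num]
  exact congrArg₂ (fun a b => adjoint (opF₁ α) a + opF₁ α b) (embed_neg_one k) (embed_natCast k 0)

theorem dilation_one_snd_add_two (α : ℂ) (k : KSpace) (n : ℕ) :
    (dilation α 1 k).snd (n + 2)
      = adjoint (opF₁ α) (k.snd n) + opF₁ α (k.snd (n + 1)) := by
  rw [dilation_snd_apply, biTriple_one_apply,
    show ((n + 2 : ℕ) : ℤ) - 1 = (n + 1 : ℕ) by push_cast; ring,
    show ((n + 1 : ℕ) : ℤ) - 1 = (n : ℕ) by push_cast; ring]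
  exact congrArg₂ (fun a b => adjoint (opF₁ α) a + opF₁ α b) (embed_natCast k n)
    (embed_natCast k (n + 1))

theorem dilation_two_snd_zero (α : ℂ) (k : KSpace) : (dilation α 2 k).snd 0 = 0 := by
  rw [dilation_snd_apply, biTriple_two_apply, show ((0 : ℕ) : ℤ) - 1 - 1 = -2 by norm_num]
  exact embed_neg_two k

theorem dilation_two_snd_one (α : ℂ) (k : KSpace) :
    (dilation α 2 k).snd 1 = defectTo opP k.fst := by
  rw [dilation_snd_apply, biTriple_two_apply, show ((1 : ℕ) : ℤ) - 1 - 1 = -1 by norm_num]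
  exact embed_neg_one k

theorem dilation_two_snd_add_two (α : ℂ) (k : KSpace) (n : ℕ) :
    (dilation α 2 k).snd (n + 2) = k.snd n := by
  rw [dilation_snd_apply, biTriple_two_apply,
    show ((n + 2 : ℕ) : ℤ) - 1 - 1 = (n : ℕ) by push_cast; ring]
  exact embed_natCast k n

theorem dilation_two_apply_snd (α : ℂ) (x : Ell2 DP) :
    dilation α 2 (WithLp.toLp 2 (0, x)) = WithLp.toLp 2 (0, shift DP (shift DP x)) := by
  have h1 : (dilation α 2 (WithLp.toLp 2 (0, x))).fst = 0 :=
    (dilation_fst α 2 _).trans (map_zero opP)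
  have h2 : (dilation α 2 (WithLp.toLp 2 (0, x))).snd = shift DP (shift DP x) := by
    ext1; funext n
    rcases n with _ | _ | n
    · exact dilation_two_snd_zero α _
    · exact (dilation_two_snd_one α _).trans (map_zero _)
    · exact dilation_two_snd_add_two α _ n
  exact WithLp.ofLp_injective 2 (Prod.ext h1 h2)

end Dilation

/-! ### First-order calculus: polynomials at the origin and in a square-zero triple. -/

section Polynomials

open MvPolynomial

/-- The derivative at the origin of a polynomial along a line. -/
theorem hasDerivAt_eval_smul (v : Fin 3 → ℂ) (p : MvPolynomial (Fin 3) ℂ) :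
    HasDerivAt (fun w : ℂ => eval (w • v) p) (∑ i, v i * p.coeff (Finsupp.single i 1)) 0 := by
  induction p using MvPolynomial.induction_on with
  | C a =>
    have h : ∀ i : Fin 3, (0 : Fin 3 →₀ ℕ) ≠ Finsupp.single i 1 := fun i h => by
      simpa using DFunLike.congr_fun h i
    simpa [coeff_C, h] using hasDerivAt_const (0 : ℂ) a
  | add p q hp hq =>
    simp only [map_add, coeff_add, mul_add, Finset.sum_add_distrib]
    exact hp.add hq
  | mul_X p i hp =>
    have h1 : HasDerivAt (fun w : ℂ => w * v i) (v i) 0 := by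
      simpa using (hasDerivAt_id (0 : ℂ)).mul_const (v i)
    have h2 := hp.mul h1
    have h3 : ∑ j, v j * (p * X i).coeff (Finsupp.single j 1) = v i * p.coeff 0 := by
      rw [Finset.sum_eq_single i]
      · simp [coeff_mul_X']
      · intro j _ hj
        have : i ∉ (Finsupp.single j 1 : Fin 3 →₀ ℕ).support := by
          simp [Ne.symm hj]
        rw [coeff_mul_X', if_neg this, mul_zero]
      · simp
    rw [h3]
    simp only [map_mul, eval_X, Pi.smul_apply, smul_eq_mul]
    refine h2.congr_deriv ?_
    simp [← constantCoeff_eq, mul_comm]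

theorem eval_zero_smul (v : Fin 3 → ℂ) (p : MvPolynomial (Fin 3) ℂ) :
    eval ((0 : ℂ) • v) p = p.coeff 0 := by
  simp [← constantCoeff_eq]

end Polynomials

section FirstOrder

universe u

variable {E : Type u} [NormedAddCommGroup E] [InnerProductSpace ℂ E]

/-- The operator `a + b S + c R`. -/
def firstOrder (S R : E →L[ℂ] E) (a b c : ℂ) : E →L[ℂ] E := a • 1 + b • S + c • R

variable {S R : E →L[ℂ] E}

theorem firstOrder_mul (hSS : S * S = 0) (hRR : R * R = 0) (hSR : S * R = 0) (hRS : R * S = 0)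
    (a b c a' b' c' : ℂ) : firstOrder S R a b c * firstOrder S R a' b' c'
      = firstOrder S R (a * a') (a * b' + b * a') (a * c' + c * a') := by
  simp only [firstOrder, mul_add, add_mul, smul_mul_smul_comm, hSS, hRR, hSR, hRS, one_mul,
    mul_one, smul_zero]
  module

/-- A monomial of degree at least two contains `S²`, `S R`, `R²` or the factor `0`; only the
constant and the two linear terms in `S` and `R` survive. -/
theorem polyEval_eq_firstOrder (hSS : S * S = 0) (hRR : R * R = 0) (hSR : S * R = 0)
    (p : MvPolynomial (Fin 3) ℂ) :
    polyEval ![S, 0, R] p = firstOrder S R (p.coeff 0) (p.coeff (Finsupp.single 0 1))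
      (p.coeff (Finsupp.single 2 1)) := by
  have hmon : ∀ m : Fin 3 →₀ ℕ, S ^ m 0 * 0 ^ m 1 * R ^ m 2
      = (if m = 0 then 1 else 0) + (if m = Finsupp.single 0 1 then S else 0)
        + (if m = Finsupp.single 2 1 then R else 0) := by
    intro m
    simp only [Finsupp.ext_iff, Fin.forall_fin_succ, Finsupp.single_apply]
    simp
    rcases hb : m 1 with _ | b
    · rcases ha : m 0 with _ | _ | a
      · rcases hc : m 2 with _ | _ | c
        · simp
        · simp
        · simp [pow_succ, mul_assoc, hRR]
      · rcases hc : m 2 with _ | c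
        · simp
        · simp [pow_succ', ← mul_assoc, hSR]
      · simp [pow_succ, mul_assoc, hSS]
    · simp
  have hsum : ∀ (n : Fin 3 →₀ ℕ) (X : E →L[ℂ] E),
      ∑ m ∈ p.support, p.coeff m • (if m = n then X else 0) = p.coeff n • X := by
    intro n X
    simp only [smul_ite, smul_zero, Finset.sum_ite_eq']
    split_ifs with h
    · rfl
    · rw [MvPolynomial.notMem_support_iff.mp h, zero_smul]
  have h : polyEval ![S, 0, R] p
      = ∑ m ∈ p.support, p.coeff m • (S ^ m 0 * 0 ^ m 1 * R ^ m 2) := rfl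
  simp only [h, hmon, smul_add, Finset.sum_add_distrib, hsum, firstOrder]

theorem firstOrder_mul_inverse (hSS : S * S = 0) (hRR : R * R = 0) (hSR : S * R = 0)
    (hRS : R * S = 0) {a : ℂ} (ha : a ≠ 0) (b c : ℂ) :
    firstOrder S R a b c * firstOrder S R a⁻¹ (-b / a ^ 2) (-c / a ^ 2) = 1 ∧
    firstOrder S R a⁻¹ (-b / a ^ 2) (-c / a ^ 2) * firstOrder S R a b c = 1 := by
  rw [firstOrder_mul hSS hRR hSR hRS, firstOrder_mul hSS hRR hSR hRS]
  have h1 : firstOrder S R 1 0 0 = 1 := by simp [firstOrder]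
  constructor
  · rw [← h1]; congr 1 <;> field_simp <;> ring
  · rw [← h1]; congr 1 <;> field_simp <;> ring

theorem isUnit_sub_smul {T : E →L[ℂ] E} (hT : T * T = 0) {l : ℂ} (hl : l ≠ 0) :
    IsUnit (T - l • ContinuousLinearMap.id ℂ E) := by
  have h1 := firstOrder_mul_inverse (S := T) (R := 0) hT (mul_zero _) (mul_zero _) (zero_mul _)
    (neg_ne_zero.mpr hl) 1 0
  have h2 : firstOrder T 0 (-l) 1 0 = T - l • ContinuousLinearMap.id ℂ E := by
    rw [firstOrder, smul_zero, add_zero, one_smul, neg_smul, neg_add_eq_sub]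
    rfl
  rw [← h2]
  exact ⟨⟨_, _, h1.1, h1.2⟩, rfl⟩

/-- If some `l k ≠ 0`, then `T k - l k` is invertible because `T k` squares to zero, and one
invertible member makes the complex exact. -/
theorem taylorSpectrum_subset_zero {T : Fin 3 → (E →L[ℂ] E)}
    (hc : ∀ i j, Commute (T i) (T j)) (hT : ∀ i, T i * T i = 0) : taylorSpectrum T ⊆ {0} := by
  intro l hl
  by_contra hne
  obtain ⟨k, hk⟩ : ∃ k, l k ≠ 0 := Function.ne_iff.mp hne
  have hid : ∀ (a : ℂ) (S : E →L[ℂ] E), Commute S (a • ContinuousLinearMap.id ℂ E) :=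
    fun a S => (Commute.one_right S).smul_right a
  exact hl (koszulExact_of_isUnit (T := fun i => T i - l i • ContinuousLinearMap.id ℂ E)
    (fun i j => ((hc i j).sub_right (hid _ _)).sub_left ((hid _ _).symm)) (k := k)
    (isUnit_sub_smul (hT k) hk))

end FirstOrder

/-! ### Splitting off the zeroth term of a sequence. -/

section SequenceDecomposition

variable {G : Type*} [NormedAddCommGroup G] [InnerProductSpace ℂ G]

theorem exists_eq_single_add_shift (x : Ell2 G) :
    ∃ y : Ell2 G, x = lp.single 2 0 (x 0) + shift G y := by
  refine ⟨ofSummable (fun n => x (n + 1))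
    ((summable_nat_add_iff 1).mpr (hasSum_norm_sq x).summable), ?_⟩
  ext1; funext n
  rcases n with _ | n
  · rw [lp.coeFn_add, Pi.add_apply, lp.single_apply_self, shift_apply_zero, add_zero]
  · rw [lp.coeFn_add, Pi.add_apply, lp.single_apply_ne _ _ _ (Nat.succ_ne_zero n), zero_add,
      shift_apply_succ]
    rfl

theorem norm_sq_single_add_shift (u : G) (y : Ell2 G) :
    ‖lp.single 2 0 u + shift G y‖ ^ 2 = ‖u‖ ^ 2 + ‖y‖ ^ 2 := by
  rw [sq, sq, sq, norm_add_sq_eq_norm_sq_add_norm_sq_of_inner_eq_zero (𝕜 := ℂ), norm_shift,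
    lp.norm_single (by norm_num)]
  rw [lp.inner_single_left, shift_apply_zero, inner_zero_right]

end SequenceDecomposition

/-! ### The contraction property of `(A_α, 0, P)`. -/

section Contraction

open Metric

theorem mem_closedTetrablock_of_norm_le {M : Matrix (Fin 2) (Fin 2) ℂ}
    (h : ∀ x y : ℂ, ‖M 0 0 * x + M 0 1 * y‖ ^ 2 + ‖M 1 0 * x + M 1 1 * y‖ ^ 2
      ≤ ‖x‖ ^ 2 + ‖y‖ ^ 2) : piMap M ∈ closedTetrablock := by
  refine ⟨M, ContinuousLinearMap.opNorm_le_bound _ zero_le_one fun x => ?_, rfl⟩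
  rw [one_mul, ← sq_le_sq₀ (norm_nonneg _) (norm_nonneg _), EuclideanSpace.norm_sq_eq,
    EuclideanSpace.norm_sq_eq, Fin.sum_univ_two, Fin.sum_univ_two, Matrix.ofLp_toEuclideanCLM]
  simpa [Matrix.mulVec, dotProduct, Fin.sum_univ_two] using h (x 0) (x 1)

theorem smul_first_mem_closedTetrablock {α w : ℂ} (hα : ‖α‖ ≤ 1) (hw : ‖w‖ ≤ 1) :
    w • ![α, 0, 0] ∈ closedTetrablock := by
  have h := mem_closedTetrablock_of_norm_le (M := !![w * α, 0; 0, 0]) fun x y => by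
    have h1 : ‖w * α * x‖ ≤ ‖x‖ := by
      rw [norm_mul, norm_mul]
      exact mul_le_of_le_one_left (norm_nonneg _) (mul_le_one₀ hw (norm_nonneg _) hα)
    have h2 := pow_le_pow_left₀ (norm_nonneg _) h1 2
    simp only [Matrix.of_apply, Matrix.cons_val', Matrix.cons_val_zero, Matrix.cons_val_one,
      Matrix.cons_val_fin_one, zero_mul, add_zero, norm_zero]
    nlinarith [sq_nonneg ‖y‖]
  convert h using 1
  funext i
  fin_cases i <;> simp [piMap, Matrix.det_fin_two]

theorem smul_last_mem_closedTetrablock {w : ℂ} (hw : ‖w‖ ≤ 1) :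
    w • ![0, 0, 1] ∈ closedTetrablock := by
  -- A contraction with zero diagonal and determinant `w`.
  have h := mem_closedTetrablock_of_norm_le (M := !![0, w; -1, 0]) fun x y => by
    have h1 : ‖w * y‖ ≤ ‖y‖ := by
      rw [norm_mul]
      exact mul_le_of_le_one_left (norm_nonneg _) hw
    have h2 := pow_le_pow_left₀ (norm_nonneg _) h1 2
    simp only [Matrix.of_apply, Matrix.cons_val', Matrix.cons_val_zero, Matrix.cons_val_one,
      Matrix.cons_val_fin_one, zero_mul, add_zero, zero_add, neg_mul, one_mul, norm_neg]
    linarith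
  convert h using 1
  funext i
  fin_cases i <;> simp [piMap, Matrix.det_fin_two]

theorem zero_mem_closedTetrablock : 0 ∈ closedTetrablock := by
  simpa using smul_last_mem_closedTetrablock (w := 0) (by simp)

theorem firstOrder_apply (α a b c : ℂ) (x : HSpace) : firstOrder (opA α) opP a b c x
    = WithLp.toLp 2 ![a • x 0, a • x 1,
        a • x 2 + b • opH α (x 2) + c • shift (EuclideanSpace ℂ (Fin 2)) (x 1),
        a • x 3 + c • x 0] := by
  ext1 i
  fin_cases i <;> simp [firstOrder, opA_apply, opP_apply]

/-- Write `x₂ = e₀ u + T_z y`. The operator is an orthogonal sum of blocks `[[a, 0], [c, a]]` acting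
on `(x₀, x₃)` and on `(x₁, y)`, and of one with `α b` in place of `c` acting on the two coordinates
of `u`, the second one first. -/
theorem norm_firstOrder_le {α a b c : ℂ} {C : ℝ} (hC : 0 < C)
    (hc : C * ‖c‖ ≤ C ^ 2 - ‖a‖ ^ 2) (hb : C * ‖α * b‖ ≤ C ^ 2 - ‖a‖ ^ 2) :
    ‖firstOrder (opA α) opP a b c‖ ≤ C := by
  refine ContinuousLinearMap.opNorm_le_bound _ hC.le fun x => ?_
  rw [← sq_le_sq₀ (norm_nonneg _) (by positivity), mul_pow, norm_sq_HSpace, norm_sq_HSpace,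
    firstOrder_apply]
  obtain ⟨y, hy⟩ := exists_eq_single_add_shift (x 2)
  have h2 : a • x 2 + b • opH α (x 2) + c • shift (EuclideanSpace ℂ (Fin 2)) (x 1)
      = lp.single 2 0 (a • x 2 0 + b • !₂[α * x 2 0 1, 0])
        + shift (EuclideanSpace ℂ (Fin 2)) (c • x 1 + a • y) := by
    rw [opH_apply, lp.single_add, lp.single_smul, lp.single_smul, map_add, map_smul, map_smul]
    nth_rewrite 1 [hy]
    module
  have h3 : ‖x 2‖ ^ 2 = ‖x 2 0‖ ^ 2 + ‖y‖ ^ 2 := by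
    nth_rewrite 1 [hy]
    exact norm_sq_single_add_shift _ _
  have h4 : ‖a • x 2 0 + b • (!₂[α * x 2 0 1, 0] : EuclideanSpace ℂ (Fin 2))‖ ^ 2
      ≤ C ^ 2 * ‖x 2 0‖ ^ 2 := by
    have h := norm_sq_add_norm_sq_le hC hb (x 2 0 1) (x 2 0 0)
    rw [EuclideanSpace.norm_sq_eq, EuclideanSpace.norm_sq_eq, Fin.sum_univ_two, Fin.sum_univ_two,
      add_comm (‖x 2 0 0‖ ^ 2)]
    refine le_trans (le_of_eq ?_) h
    simp only [PiLp.add_apply, PiLp.smul_apply, smul_eq_mul, Matrix.cons_val_zero,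
      Matrix.cons_val_one, Matrix.cons_val_fin_one, mul_zero, add_zero]
    rw [add_comm, show a * x 2 0 0 + b * (α * x 2 0 1) = α * b * x 2 0 1 + a * x 2 0 0 by ring]
  have h5 := norm_sq_add_norm_sq_le hC hc (x 1) y
  have h6 := norm_sq_add_norm_sq_le hC hc (x 0) (x 3)
  rw [h2, h3]
  simp only [Matrix.cons_val_zero, Matrix.cons_val_one, Matrix.cons_val]
  rw [norm_sq_single_add_shift, add_comm (a • x 3)]
  linarith

theorem triple_commute (α : ℂ) (i j : Fin 3) : Commute (triple α i) (triple α j) := by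
  have h : Commute (opA α) opP := by
    ext1 x
    exact (opA_opP α x).trans (opP_opA α x).symm
  fin_cases i <;> fin_cases j
  exacts [Commute.refl _, Commute.zero_right _, h, Commute.zero_left _, Commute.refl _,
    Commute.zero_left _, h.symm, Commute.zero_right _, Commute.refl _]

theorem triple_mul_self (α : ℂ) (i : Fin 3) : triple α i * triple α i = 0 := by
  fin_cases i
  · ext1 x; exact opA_opA α x
  · exact zero_mul _
  · ext1 x; exact opP_opP x

/-- Schwarz–Pick for `w ↦ (p / q)(w v)` on the unit disc, with value and derivative at `0` written
in coefficients. -/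
theorem mul_norm_deriv_quotient_le {v : Fin 3 → ℂ} {p q : MvPolynomial (Fin 3) ℂ} {C : ℝ}
    (hv : ∀ w : ℂ, ‖w‖ ≤ 1 → w • v ∈ closedTetrablock)
    (hq : ∀ z ∈ closedTetrablock, MvPolynomial.eval z q ≠ 0)
    (hC : ∀ z ∈ closedTetrablock, ‖MvPolynomial.eval z p / MvPolynomial.eval z q‖ ≤ C) :
    C * ‖((∑ i, v i * p.coeff (Finsupp.single i 1)) * q.coeff 0
      - p.coeff 0 * ∑ i, v i * q.coeff (Finsupp.single i 1)) / q.coeff 0 ^ 2‖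
      ≤ C ^ 2 - ‖p.coeff 0 / q.coeff 0‖ ^ 2 := by
  have hball : ∀ w ∈ ball (0 : ℂ) 1, w • v ∈ closedTetrablock := fun w hw =>
    hv w (mem_ball_zero_iff.mp hw).le
  have hdiff : ∀ r : MvPolynomial (Fin 3) ℂ,
      Differentiable ℂ fun w : ℂ => MvPolynomial.eval (w • v) r := by
    intro r
    simp only [MvPolynomial.eval_eq', Pi.smul_apply, smul_eq_mul]
    fun_prop
  have h0 : MvPolynomial.eval ((0 : ℂ) • v) q ≠ 0 := hq _ (hv 0 (by simp))
  have hd := (hasDerivAt_eval_smul v p).div (hasDerivAt_eval_smul v q) h0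
  have h := mul_norm_deriv_le_of_norm_le
    ((hdiff p).differentiableOn.div (hdiff q).differentiableOn fun w hw => hq _ (hball w hw)) hd
    fun w hw => hC _ (hball w hw)
  simpa only [Pi.div_apply, eval_zero_smul] using h

theorem isTetrablockContraction_triple {α : ℂ} (hα : ‖α‖ ≤ 1) :
    IsTetrablockContraction (triple α) := by
  refine ⟨triple_commute α, fun l hl => ?_, fun p q hq => ?_⟩
  · rw [Set.mem_singleton_iff.mp (taylorSpectrum_subset_zero (triple_commute α)
      (triple_mul_self α) hl)]
    exact zero_mem_closedTetrablock
  have hSS : opA α * opA α = 0 := triple_mul_self α 0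
  have hRR : opP * opP = 0 := triple_mul_self α 2
  have hSR : opA α * opP = 0 := by ext1 x; exact opA_opP α x
  have hRS : opP * opA α = 0 := by ext1 x; exact opP_opA α x
  have hpoly : ∀ r, polyEval (triple α) r = firstOrder (opA α) opP (r.coeff 0)
      (r.coeff (Finsupp.single 0 1)) (r.coeff (Finsupp.single 2 1)) :=
    polyEval_eq_firstOrder hSS hRR hSR
  have hq0 : q.coeff 0 ≠ 0 := by
    have h := hq 0 zero_mem_closedTetrablock
    rwa [← zero_smul ℂ (0 : Fin 3 → ℂ), eval_zero_smul] at h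
  obtain ⟨hl, hr⟩ := firstOrder_mul_inverse hSS hRR hSR hRS hq0
    (q.coeff (Finsupp.single 0 1)) (q.coeff (Finsupp.single 2 1))
  rw [hpoly q]
  refine ⟨⟨⟨_, _, hl, hr⟩, rfl⟩, fun C hC => ?_⟩
  rw [Ring.inverse_unit ⟨_, _, hl, hr⟩, hpoly p]
  change ‖firstOrder (opA α) opP _ _ _ * firstOrder (opA α) opP _ _ _‖ ≤ C
  rw [firstOrder_mul hSS hRR hSR hRS]
  have hC0 : 0 ≤ C := (norm_nonneg _).trans (hC 0 zero_mem_closedTetrablock)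
  -- `C` may be `0`, while `norm_firstOrder_le` needs a positive bound.
  refine le_of_forall_gt_imp_ge_of_dense fun R hR => ?_
  have hCR : ∀ z ∈ closedTetrablock,
      ‖MvPolynomial.eval z p / MvPolynomial.eval z q‖ ≤ R := fun z hz => (hC z hz).trans hR.le
  have h1 := mul_norm_deriv_quotient_le
    (fun w hw => smul_first_mem_closedTetrablock hα hw) hq hCR
  have h2 := mul_norm_deriv_quotient_le (fun w hw => smul_last_mem_closedTetrablock hw) hq hCR
  simp only [Fin.sum_univ_three, Matrix.cons_val_zero, Matrix.cons_val_one, Matrix.cons_val,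
    zero_mul, add_zero, zero_add, one_mul] at h1 h2
  refine norm_firstOrder_le (hC0.trans_lt hR) ?_ ?_
  · rw [← div_eq_mul_inv]
    refine le_trans (le_of_eq ?_) h2
    congr 2
    field_simp
    ring
  · rw [← div_eq_mul_inv]
    refine le_trans (le_of_eq ?_) h1
    congr 2
    field_simp
    ring

end Contraction

end Tetrablock

end

theorem mainTheorem2 (α : ℂ) (hα : ‖α‖ ≤ 1) :
    -- the defect operator and the defect space of `P`
    (∀ x : Tetrablock.HSpace,
      Tetrablock.defect Tetrablock.opP x = WithLp.toLp 2 ![0, 0, x 2, x 3]) ∧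
    (∀ x : Tetrablock.HSpace, x ∈ Tetrablock.DP ↔ x 0 = 0 ∧ x 1 = 0) ∧
    -- `F₁` and `F₂` are the unique solutions of the fundamental equations
    (∀ X : Tetrablock.DP →L[ℂ] Tetrablock.DP,
      Tetrablock.opA α - ContinuousLinearMap.adjoint Tetrablock.opB * Tetrablock.opP
        = Tetrablock.defectSandwich Tetrablock.opP X ↔ X = Tetrablock.opF₁ α) ∧
    (∀ X : Tetrablock.DP →L[ℂ] Tetrablock.DP,
      Tetrablock.opB - ContinuousLinearMap.adjoint (Tetrablock.opA α) * Tetrablock.opP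
        = Tetrablock.defectSandwich Tetrablock.opP X ↔ X = Tetrablock.opF₂) ∧
    -- they commute, but their self-commutators differ when `α ≠ 0`
    Commute (Tetrablock.opF₁ α) Tetrablock.opF₂ ∧
    (α ≠ 0 →
      Tetrablock.opF₁ α * ContinuousLinearMap.adjoint (Tetrablock.opF₁ α)
          - ContinuousLinearMap.adjoint (Tetrablock.opF₁ α) * Tetrablock.opF₁ α
        ≠ Tetrablock.opF₂ * ContinuousLinearMap.adjoint Tetrablock.opF₂
          - ContinuousLinearMap.adjoint Tetrablock.opF₂ * Tetrablock.opF₂) ∧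
    -- the explicit block operator matrices define bounded operators `V₁`, `V₂`, `V₃` on `𝒦`
    (∃ V : Fin 3 → (Tetrablock.KSpace →L[ℂ] Tetrablock.KSpace),
      (∀ (h : Tetrablock.HSpace) (x : Tetrablock.Ell2 Tetrablock.DP),
        (V 0 (WithLp.toLp 2 (h, x))).fst = Tetrablock.opA α h ∧
        (V 0 (WithLp.toLp 2 (h, x))).snd 0
          = ContinuousLinearMap.adjoint (Tetrablock.opF₁ α)
              (Tetrablock.defectTo Tetrablock.opP h) + Tetrablock.opF₁ α (x 0) ∧
        (∀ n : ℕ, (V 0 (WithLp.toLp 2 (h, x))).snd (n + 1)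
          = ContinuousLinearMap.adjoint (Tetrablock.opF₁ α) (x n)
              + Tetrablock.opF₁ α (x (n + 1)))) ∧
      (∀ (h : Tetrablock.HSpace) (x : Tetrablock.Ell2 Tetrablock.DP),
        (V 1 (WithLp.toLp 2 (h, x))).fst = Tetrablock.opB h ∧
        (V 1 (WithLp.toLp 2 (h, x))).snd 0
          = Tetrablock.opF₁ α (Tetrablock.defectTo Tetrablock.opP h) ∧
        (V 1 (WithLp.toLp 2 (h, x))).snd 1
          = ContinuousLinearMap.adjoint (Tetrablock.opF₁ α)
              (Tetrablock.defectTo Tetrablock.opP h) + Tetrablock.opF₁ α (x 0) ∧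
        (∀ n : ℕ, (V 1 (WithLp.toLp 2 (h, x))).snd (n + 2)
          = ContinuousLinearMap.adjoint (Tetrablock.opF₁ α) (x n)
              + Tetrablock.opF₁ α (x (n + 1)))) ∧
      (∀ (h : Tetrablock.HSpace) (x : Tetrablock.Ell2 Tetrablock.DP),
        (V 2 (WithLp.toLp 2 (h, x))).fst = Tetrablock.opP h ∧
        (V 2 (WithLp.toLp 2 (h, x))).snd 0 = 0 ∧
        (V 2 (WithLp.toLp 2 (h, x))).snd 1 = Tetrablock.defectTo Tetrablock.opP h ∧
        (∀ n : ℕ, (V 2 (WithLp.toLp 2 (h, x))).snd (n + 2) = x n)) ∧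
      -- `V₃` is the square of the shift on the orthogonal complement of `ℋ`
      (∀ x : Tetrablock.Ell2 Tetrablock.DP,
        V 2 (WithLp.toLp 2 (0, x))
          = WithLp.toLp 2 (0, Tetrablock.shift Tetrablock.DP (Tetrablock.shift Tetrablock.DP x))) ∧
      -- the triple commutes, `V₃` is an isometry, `V₁ = V₂^* V₃`, and the norms are `|α|`
      (∀ i j, Commute (V i) (V j)) ∧
      Isometry (V 2) ∧
      V 0 = ContinuousLinearMap.adjoint (V 1) * V 2 ∧
      ‖V 0‖ = ‖α‖ ∧ ‖V 1‖ = ‖α‖ ∧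
      -- the triple is a tetrablock isometric dilation of `(A_α, 0, P)`
      Tetrablock.IsTetrablockIsometricDilation Tetrablock.inclH (Tetrablock.triple α) V) ∧
    -- in particular `(A_α, 0, P)` is a tetrablock contraction
    Tetrablock.IsTetrablockContraction (Tetrablock.triple α) := by
  open Tetrablock in
  refine ⟨fun x => by rw [defect_opP, lastTwo_apply], mem_DP_iff_zero,
    eq_defectSandwich_opP_iff fun x => ?_, eq_defectSandwich_opP_iff fun x => ?_,
    Commute.zero_right _, fun hne => ?_,
    ⟨dilation α, fun h x => ⟨rfl, dilation_zero_snd_zero α _, dilation_zero_snd_succ α _⟩,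
      fun h x => ⟨rfl, dilation_one_snd_zero α _, dilation_one_snd_one α _,
        dilation_one_snd_add_two α _⟩,
      fun h x => ⟨rfl, dilation_two_snd_zero α _, dilation_two_snd_one α _,
        dilation_two_snd_add_two α _⟩,
      dilation_two_apply_snd α, dilation_commute α, isometry_dilation_two α, dilation_zero_eq α,
      norm_dilation_zero α, norm_dilation_one α, isTetrablockIsometricDilation_dilation hα⟩,
    isTetrablockContraction_triple hα⟩
  · exact (opA_sub_adjoint_opB_mul_opP_apply α x).trans (opF₁_defectTo α x).symm
  -- Both sides vanish: `B = 0`, and `A^* P = 0` since `H^* T_z = 0`.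
  · exact opB_sub_adjoint_opA_mul_opP_apply α x
  · exact fun h => opF₁_selfCommutator_ne_zero hne (h.trans opF₂_selfCommutator)
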